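/- Let $n\ge 0$ be an integer and let $S_n$ be the symmetric group on $[n]=\{1,\dots,n\}$, with $\alpha\beta$ denoting "first $\beta$, then $\alpha$". Let $H(\sigma,\tau)=|\{a\in[n]:\sigma(a)\ne\tau(a)\}|$ be the Hamming metric. For $\beta\in S_n$ and $k\ge 0$ let \[ c(k,\beta)=|\{\alpha\in S_n : H(\alpha\beta,\beta\alpha)=k\}| . \] For an (unordered) partition $[k_1,\dots,k_h]$ of $k$ into positive integers, let $c([k_1,\dots,k_h],\beta)$ be the number of $\alpha\in S_n$ with $H(\alpha\beta,\beta\alpha)=k$ such that exactly $h$ cycles in the disjoint cycle decomposition of $\beta$ (fixed points count as cycles of length $1$) contain a point $a$ with $\alpha\beta(a)\neq\beta\alpha(a)$, and the numbers of such points in these $h$ cycles are, in some order, $k_1,\dots,k_h$. Let $C_{S_n}(\beta)$ be the centralizer of $\beta$ in $S_n$. **Theorem.** Let $\beta\in S_n$ have cycle type $(c_1,\dots,c_n)$, that is, $\beta$ has exactly $c_i$ cycles of length $i$ for each $i$ (and $c_i=0$ for $i>n$). Then \[ c(4,\beta)=c([4],\beta)+c([3,1],\beta)+c([2,2],\beta)+c([2,1,1],\beta),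 \] where \begin{align*} c([4],\beta)&=|C_{S_n}(\beta)|\sum_{i\ge 4}c_i\binom{i}{4},\\ c([3,1],\beta)&=|C_{S_n}(\beta)|\sum_{i\ge 1,\ j\ge i+2} ij(j-i-1)\,c_ic_j,\\ c([2,2],\beta)&=|C_{S_n}(\beta)|\Big(\sum_{i\ge 2} i\binom{i}{2}\binom{c_i}{2}+\sum_{j>i\ge 2} i(i-1)j\,c_ic_j\Big),\\ c([2,1,1],\beta)&=|C_{S_n}(\beta)|\Big(\sum_{i\ge 1} i^3c_{2i}\binom{c_i}{2}+\sum_{j>i\ge 1} ij(i+j)\,c_ic_jc_{i+j}\Big). \end{align*} -/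

import Mathlib

namespace KCommute

/-- The cycles of `β` (fixed points included, as cycles of length one), each represented by its
set of points. -/
def cycles {n : ℕ} (β : Equiv.Perm (Fin n)) : Finset (Finset (Fin n)) :=
  Finset.univ.image fun x => Finset.univ.filter fun y => β.SameCycle x y

/-- The number `c_i` of cycles of length `i` of `β`; the cycle type of `β` is `(c_1, …, c_n)`. -/
def cycleCount {n : ℕ} (β : Equiv.Perm (Fin n)) (i : ℕ) : ℕ :=
  ((cycles β).filter fun s => s.card = i).card

/-- The number of points of `s` on which `α` and `β` do not commute (bad commuting points). When
`s` is a cycle of `β`, `α` is said to `(k, β)`-commute with `s` if this number is `k`. -/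
def badCount {n : ℕ} (α β : Equiv.Perm (Fin n)) (s : Finset (Fin n)) : ℕ :=
  (s.filter fun x => (α * β) x ≠ (β * α) x).card

/-- `C(k, β)`: the permutations `α` with `H(αβ, βα) = k`, where `H` is the Hamming metric. -/
def kCommuting {n : ℕ} (k : ℕ) (β : Equiv.Perm (Fin n)) : Finset (Equiv.Perm (Fin n)) :=
  Finset.univ.filter fun α => hammingDist (⇑(α * β)) (⇑(β * α)) = k

/-- `C(μ, β)` for an (unordered) integer partition `μ = [k_1, …, k_h]` with positive parts: the
permutations `α` that `k`-commute with `β`, `k = k_1 + ⋯ + k_h`, such that exactly `h` cycles of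
`β` contain bad commuting points, and the numbers of bad commuting points in these cycles are
`k_1, …, k_h` (with multiplicity). -/
def kCommutingOfType {n : ℕ} (μ : Multiset ℕ) (β : Equiv.Perm (Fin n)) :
    Finset (Equiv.Perm (Fin n)) :=
  (kCommuting μ.sum β).filter fun α =>
    ((cycles β).filter fun s => badCount α β s ≠ 0).val.map (badCount α β) = μ

/-- `c(k, β) = |C(k, β)|`. -/
def numKCommuting {n : ℕ} (k : ℕ) (β : Equiv.Perm (Fin n)) : ℕ :=
  (kCommuting k β).card

/-- `c(μ, β) = |C(μ, β)|`. -/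
def numOfType {n : ℕ} (μ : Multiset ℕ) (β : Equiv.Perm (Fin n)) : ℕ :=
  (kCommutingOfType μ β).card

/-- `|C_{S_n}(β)|`, the order of the centralizer of `β` in the symmetric group. -/
noncomputable def centralizerOrder {n : ℕ} (β : Equiv.Perm (Fin n)) : ℕ :=
  Nat.card (Subgroup.centralizer ({β} : Set (Equiv.Perm (Fin n))))

end KCommute

/-! Write `f` for `β`. A point is bad for `a` exactly when it is moved by `p = f⁻¹ * (a⁻¹ * f * a)`,
and `f * p` is then a conjugate of `f`. The map `a ↦ a⁻¹ * f * a` has fibres of the size of the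
centralizer, so every count equals that size times the number of `p` with four moved points, in the
prescribed positions relative to the cycles of `f`, such that `f * p` has the cycle lengths of `f`
(`card_filter_conj`, `card_filter_eq_mul_numPerturb`).

Conjugate permutations have the same sign, so `p` is even. A 4-cycle is odd; hence `p` is a product
of two disjoint transpositions `(a b)(c d)`, and exactly eight ordered quadruples give the same `p`
(`quad_swap_mul_swap`).

Multiplying by a transposition joins two cycles or cuts one in two. To keep all cycle lengths, one
of the two factors must join and the other must cut, and the resulting lengths must be the old ones.
Four points in four cycles would force two joins, so the type `[1,1,1,1]` does not occur; this gives
the decomposition of `c(4, β)`. Each remaining type becomes an arithmetic condition on positions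
along cycles: two crossing chords of one cycle (`good_iff_of_sameCycle`), a distance equal to the
length of another cycle (`good_iff_of_isolated_left`), matching distances in two cycles
(`good_iff_of_pair_pair`), or a cycle cut into the lengths of two joined ones
(`good_iff_of_isolated_isolated`). Counting the solutions gives the four formulas. -/

namespace KCommute

open Equiv Equiv.Perm

/-- The cycle of `f` through `x`, as a set of points. -/
def cyc {n : ℕ} (f : Perm (Fin n)) (x : Fin n) : Finset (Fin n) :=
  Finset.univ.filter fun y => f.SameCycle x y

/-- The length of the cycle of `f` through `x`. -/
noncomputable def len {n : ℕ} (f : Perm (Fin n)) (x : Fin n) : ℕ :=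
  Function.minimalPeriod f x

/-- The multiset of cycle lengths of `f`, fixed points included. -/
def lens {n : ℕ} (f : Perm (Fin n)) : Multiset ℕ :=
  (cycles f).val.map Finset.card

/-! ### Cycles as orbits of powers -/

section Basic

variable {n : ℕ} {f : Perm (Fin n)} {x y z : Fin n}

theorem mem_cyc : y ∈ cyc f x ↔ f.SameCycle x y := by simp [cyc]

theorem self_mem_cyc : x ∈ cyc f x := mem_cyc.2 (SameCycle.refl _ _)

theorem cyc_eq_iff : cyc f x = cyc f y ↔ f.SameCycle x y := by
  constructor
  · intro h
    exact mem_cyc.1 (h ▸ self_mem_cyc)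
  · intro h
    ext z
    simp only [mem_cyc]
    exact ⟨fun h' => h.symm.trans h', fun h' => h.trans h'⟩

theorem cycles_eq_image (f : Perm (Fin n)) : cycles f = Finset.univ.image (cyc f) := rfl

theorem mem_cycles {s : Finset (Fin n)} : s ∈ cycles f ↔ ∃ x, cyc f x = s := by
  simp [cycles_eq_image]

theorem cyc_mem_cycles : cyc f x ∈ cycles f := mem_cycles.2 ⟨x, rfl⟩

theorem eq_cyc_of_mem {s : Finset (Fin n)} (hs : s ∈ cycles f) (hx : x ∈ s) : s = cyc f x := by
  obtain ⟨y, rfl⟩ := mem_cycles.1 hs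
  exact cyc_eq_iff.2 (mem_cyc.1 hx)

theorem len_pos : 0 < len f x := by
  refine Function.IsPeriodicPt.minimalPeriod_pos (orderOf_pos f) ?_
  rw [Function.IsPeriodicPt, Function.IsFixedPt, Equiv.Perm.iterate_eq_pow, pow_orderOf_eq_one]
  rfl

theorem pow_len : (f ^ len f x) x = x := by
  rw [← Equiv.Perm.iterate_eq_pow]
  exact Function.iterate_minimalPeriod

theorem pow_mod_len (k : ℕ) : (f ^ (k % len f x)) x = (f ^ k) x := by
  rw [← Equiv.Perm.iterate_eq_pow, ← Equiv.Perm.iterate_eq_pow]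
  exact Function.iterate_mod_minimalPeriod_eq

theorem pow_inj {i j : ℕ} (hi : i < len f x) (hj : j < len f x) :
    (f ^ i) x = (f ^ j) x ↔ i = j := by
  rw [← Equiv.Perm.iterate_eq_pow, ← Equiv.Perm.iterate_eq_pow]
  exact Function.iterate_eq_iterate_iff_of_lt_minimalPeriod hi hj

theorem pow_ne_self {k : ℕ} (h0 : 0 < k) (hk : k < len f x) : (f ^ k) x ≠ x := by
  intro h
  have := (pow_inj (f := f) (x := x) hk len_pos).1 (by simpa using h)
  omega

theorem len_eq_of_pow {k : ℕ} (h0 : 0 < k) (hk : (f ^ k) x = x)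
    (h : ∀ t, 0 < t → t < k → (f ^ t) x ≠ x) : len f x = k := by
  have h1 : len f x ≤ k := by
    refine Function.IsPeriodicPt.minimalPeriod_le h0 ?_
    rw [Function.IsPeriodicPt, Function.IsFixedPt, Equiv.Perm.iterate_eq_pow, hk]
  rcases h1.lt_or_eq with h2 | h2
  · exact absurd pow_len (h _ len_pos h2)
  · exact h2

theorem exists_pow_of_sameCycle (h : f.SameCycle x y) : ∃ k < len f x, (f ^ k) x = y := by
  obtain ⟨k, hk⟩ := h.exists_nat_pow_eq
  exact ⟨k % len f x, Nat.mod_lt _ len_pos, by rw [pow_mod_len, hk]⟩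

theorem exists_pow_of_sameCycle_of_ne (h : f.SameCycle x y) (hxy : x ≠ y) :
    ∃ k, 0 < k ∧ k < len f x ∧ (f ^ k) x = y := by
  obtain ⟨k, hk, rfl⟩ := exists_pow_of_sameCycle h
  refine ⟨k, Nat.pos_of_ne_zero ?_, hk, rfl⟩
  rintro rfl
  exact hxy rfl

theorem sameCycle_pow (k : ℕ) : f.SameCycle x ((f ^ k) x) := ⟨k, by simp⟩

theorem cyc_eq_image : cyc f x = (Finset.range (len f x)).image fun k => (f ^ k) x := by
  ext y
  simp only [mem_cyc, Finset.mem_image, Finset.mem_range]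
  constructor
  · exact exists_pow_of_sameCycle
  · rintro ⟨k, -, rfl⟩
    exact sameCycle_pow k

theorem pow_injOn : Set.InjOn (fun k => (f ^ k) x) (Finset.range (len f x)) := by
  intro i hi j hj hij
  simp only [Finset.coe_range, Set.mem_Iio] at hi hj
  exact (pow_inj hi hj).1 hij

theorem card_cyc : (cyc f x).card = len f x := by
  rw [cyc_eq_image, Finset.card_image_of_injOn pow_injOn, Finset.card_range]

theorem sum_cyc {M : Type*} [AddCommMonoid M] (g : Fin n → M) :
    ∑ y ∈ cyc f x, g y = ∑ p ∈ Finset.range (len f x), g ((f ^ p) x) := by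
  rw [cyc_eq_image, Finset.sum_image pow_injOn]

theorem len_eq (h : f.SameCycle x y) : len f x = len f y := by
  rw [← card_cyc, ← card_cyc, cyc_eq_iff.2 h]

theorem len_le : len f x ≤ n := by
  rw [← card_cyc]
  simpa using Finset.card_le_univ (cyc f x)

end Basic

/-! ### Effect of a transposition on cycles: joining and cutting -/

section Swap

variable {n : ℕ} {f : Perm (Fin n)} {x y u v : Fin n}

/-- The product sends `x` to `f y` and then follows `f` as long as the orbit avoids both `x` and
`y`. -/
theorem mul_swap_pow_left {k : ℕ} (h : ∀ t, 0 < t → t < k → (f ^ t) y ≠ x ∧ (f ^ t) y ≠ y) :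
    ∀ t, 0 < t → t ≤ k → ((f * swap x y) ^ t) x = (f ^ t) y := by
  intro t
  induction t with
  | zero => intro h0; omega
  | succ t ih =>
    intro _ ht
    rcases Nat.eq_zero_or_pos t with rfl | h0
    · simp
    · have h1 := h t h0 (by omega)
      rw [pow_succ', Perm.mul_apply, ih h0 (by omega), Perm.mul_apply,
        swap_apply_of_ne_of_ne h1.1 h1.2, pow_succ', Perm.mul_apply]

theorem mul_swap_pow_right {k : ℕ} (h : ∀ t, 0 < t → t < k → (f ^ t) x ≠ x ∧ (f ^ t) x ≠ y) :
    ∀ t, 0 < t → t ≤ k → ((f * swap x y) ^ t) y = (f ^ t) x := by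
  rw [swap_comm]
  exact mul_swap_pow_left fun t h0 ht => (h t h0 ht).symm

theorem mul_swap_pow_of_forall_ne (h : ∀ t : ℕ, (f ^ t) u ≠ x ∧ (f ^ t) u ≠ y) (t : ℕ) :
    ((f * swap x y) ^ t) u = (f ^ t) u := by
  induction t with
  | zero => rfl
  | succ t ih =>
    rw [pow_succ', Perm.mul_apply, ih, Perm.mul_apply, swap_apply_of_ne_of_ne (h t).1 (h t).2,
      pow_succ', Perm.mul_apply]

theorem mul_swap_pow_of_not_sameCycle (hx : ¬f.SameCycle x u) (hy : ¬f.SameCycle y u) (t : ℕ) :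
    ((f * swap x y) ^ t) u = (f ^ t) u := by
  refine mul_swap_pow_of_forall_ne (fun t => ⟨?_, ?_⟩) t
  · rintro rfl
    exact hx (sameCycle_pow t).symm
  · rintro rfl
    exact hy (sameCycle_pow t).symm

theorem len_mul_swap_of_not_sameCycle (hx : ¬f.SameCycle x u) (hy : ¬f.SameCycle y u) :
    len (f * swap x y) u = len f u := by
  refine len_eq_of_pow len_pos ?_ ?_
  · rw [mul_swap_pow_of_not_sameCycle hx hy, pow_len]
  · intro t h0 ht
    rw [mul_swap_pow_of_not_sameCycle hx hy]
    exact pow_ne_self h0 ht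

theorem cyc_mul_swap_of_not_sameCycle (hx : ¬f.SameCycle x u) (hy : ¬f.SameCycle y u) :
    cyc (f * swap x y) u = cyc f u := by
  rw [cyc_eq_image, cyc_eq_image, len_mul_swap_of_not_sameCycle hx hy]
  simp only [mul_swap_pow_of_not_sameCycle hx hy]

theorem mul_swap_pow_left_of_not_sameCycle (h : ¬f.SameCycle x y) {t : ℕ} (h0 : 0 < t)
    (ht : t ≤ len f y) : ((f * swap x y) ^ t) x = (f ^ t) y := by
  refine mul_swap_pow_left (k := len f y) (fun t h0 ht => ⟨?_, pow_ne_self h0 ht⟩) t h0 ht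
  rintro rfl
  exact h (sameCycle_pow t).symm

theorem mul_swap_pow_right_of_not_sameCycle (h : ¬f.SameCycle x y) {t : ℕ} (h0 : 0 < t)
    (ht : t ≤ len f x) : ((f * swap x y) ^ t) y = (f ^ t) x := by
  rw [swap_comm]
  exact mul_swap_pow_left_of_not_sameCycle (fun h' => h h'.symm) h0 ht

theorem sameCycle_mul_swap (h : ¬f.SameCycle x y) : (f * swap x y).SameCycle x y := by
  have h1 := mul_swap_pow_left_of_not_sameCycle h len_pos le_rfl
  rw [pow_len] at h1
  have h2 := sameCycle_pow (f := f * swap x y) (x := x) (len f y)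
  rwa [h1] at h2

theorem sameCycle_mul_swap_of_sameCycle_right (h : ¬f.SameCycle x y) (hu : f.SameCycle y u) :
    (f * swap x y).SameCycle x u := by
  by_cases hyu : y = u
  · exact hyu ▸ sameCycle_mul_swap h
  · obtain ⟨k, h0, hk, rfl⟩ := exists_pow_of_sameCycle_of_ne hu hyu
    rw [← mul_swap_pow_left_of_not_sameCycle h h0 hk.le]
    exact sameCycle_pow _

theorem sameCycle_mul_swap_of_sameCycle_left (h : ¬f.SameCycle x y) (hu : f.SameCycle x u) :
    (f * swap x y).SameCycle x u := by
  have := sameCycle_mul_swap_of_sameCycle_right (fun h' => h h'.symm) hu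
  rw [swap_comm] at this
  exact (sameCycle_mul_swap h).trans this

theorem cyc_mul_swap_left (h : ¬f.SameCycle x y) :
    cyc (f * swap x y) x = cyc f x ∪ cyc f y := by
  ext u
  simp only [Finset.mem_union, mem_cyc]
  constructor
  · intro hu
    by_contra! hc
    have h1 := cyc_mul_swap_of_not_sameCycle hc.1 hc.2
    have h2 : x ∈ cyc (f * swap x y) u := mem_cyc.2 hu.symm
    rw [h1, mem_cyc] at h2
    exact hc.1 h2.symm
  · rintro (hu | hu)
    · exact sameCycle_mul_swap_of_sameCycle_left h hu
    · exact sameCycle_mul_swap_of_sameCycle_right h hu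

theorem len_mul_swap_left (h : ¬f.SameCycle x y) :
    len (f * swap x y) x = len f x + len f y := by
  rw [← card_cyc, cyc_mul_swap_left h, Finset.card_union_of_disjoint, card_cyc, card_cyc]
  rw [Finset.disjoint_left]
  intro u hu hv
  exact h ((mem_cyc.1 hu).trans (mem_cyc.1 hv).symm)

theorem sameCycle_mul_swap_of_sameCycle (h : ¬f.SameCycle x y) (huv : f.SameCycle u v) :
    (f * swap x y).SameCycle u v := by
  by_cases hx : f.SameCycle x u
  · exact (sameCycle_mul_swap_of_sameCycle_left h hx).symm.trans
      (sameCycle_mul_swap_of_sameCycle_left h (hx.trans huv))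
  by_cases hy : f.SameCycle y u
  · exact (sameCycle_mul_swap_of_sameCycle_right h hy).symm.trans
      (sameCycle_mul_swap_of_sameCycle_right h (hy.trans huv))
  have h1 := cyc_mul_swap_of_not_sameCycle hx hy
  rw [← mem_cyc, h1, mem_cyc]
  exact huv

/-- All cycles other than the two joined ones survive unchanged. The multisets are balanced by
addition, which avoids truncated subtraction and lets such identities be chained and cancelled. -/
theorem lens_mul_swap (h : ¬f.SameCycle x y) :
    lens (f * swap x y) + {len f x, len f y} = lens f + {len f x + len f y} := by
  set R : Finset (Finset (Fin n)) := (cycles f).filter fun s => s ≠ cyc f x ∧ s ≠ cyc f y with hR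
  have hne : cyc f x ≠ cyc f y := fun h' => h (cyc_eq_iff.1 h')
  have h1 : cycles f = insert (cyc f x) (insert (cyc f y) R) := by
    ext s
    simp only [Finset.mem_insert, hR, Finset.mem_filter]
    constructor
    · intro hs
      tauto
    · rintro (rfl | rfl | hs)
      · exact cyc_mem_cycles
      · exact cyc_mem_cycles
      · exact hs.1
  have h2 : cycles (f * swap x y) = insert (cyc (f * swap x y) x) R := by
    ext s
    simp only [Finset.mem_insert, hR, Finset.mem_filter]
    constructor
    · intro hs
      obtain ⟨u, rfl⟩ := mem_cycles.1 hs
      by_cases hx : f.SameCycle x u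
      · exact Or.inl (cyc_eq_iff.2 (sameCycle_mul_swap_of_sameCycle_left h hx).symm)
      by_cases hy : f.SameCycle y u
      · exact Or.inl (cyc_eq_iff.2 (sameCycle_mul_swap_of_sameCycle_right h hy).symm)
      rw [cyc_mul_swap_of_not_sameCycle hx hy]
      exact Or.inr ⟨cyc_mem_cycles, fun h' => hx (cyc_eq_iff.1 h').symm,
        fun h' => hy (cyc_eq_iff.1 h').symm⟩
    · rintro (rfl | ⟨hs, hx, hy⟩)
      · exact cyc_mem_cycles
      · obtain ⟨u, rfl⟩ := mem_cycles.1 hs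
        rw [← cyc_mul_swap_of_not_sameCycle (fun h' => hx (cyc_eq_iff.2 h').symm)
          (fun h' => hy (cyc_eq_iff.2 h').symm)]
        exact cyc_mem_cycles
  have h3 : cyc (f * swap x y) x ∉ R := by
    intro hs
    have := eq_cyc_of_mem (Finset.mem_filter.1 hs).1 (self_mem_cyc (f := f * swap x y) (x := x))
    exact (Finset.mem_filter.1 hs).2.1 this
  have h4 : cyc f y ∉ R := by simp [hR]
  have h5 : cyc f x ∉ insert (cyc f y) R := by simp [hR, hne]
  rw [lens, lens, h1, h2, Finset.insert_val_of_notMem h3, Finset.insert_val_of_notMem h5,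
    Finset.insert_val_of_notMem h4]
  simp only [Multiset.map_cons, card_cyc, len_mul_swap_left h]
  ext i
  simp only [Multiset.count_add, Multiset.insert_eq_cons, Multiset.count_cons,
    Multiset.count_singleton]
  omega

/-- A cut is a join read backwards: multiplying once more by the same transposition restores `f`. -/
theorem lens_mul_swap_of_not_sameCycle_mul_swap (h : ¬(f * swap x y).SameCycle x y) :
    lens f + {len (f * swap x y) x, len (f * swap x y) y} =
      lens (f * swap x y) + {len (f * swap x y) x + len (f * swap x y) y} := by
  have := lens_mul_swap h
  rwa [mul_assoc, swap_mul_self, mul_one] at this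

variable {k : ℕ}

theorem mul_swap_pow_self_split (hk : k < len f x) (hy : (f ^ k) x = y) {t : ℕ}
    (h0 : 0 < t) (ht : t ≤ k) : ((f * swap x y) ^ t) y = (f ^ t) x := by
  refine mul_swap_pow_right (k := k) (fun t h0 ht => ⟨pow_ne_self h0 (by omega), ?_⟩) t h0 ht
  intro h
  rw [← hy, pow_inj (by omega) (by omega)] at h
  omega

theorem len_mul_swap_split_right (hk0 : 0 < k) (hk : k < len f x) (hy : (f ^ k) x = y) :
    len (f * swap x y) y = k := by
  refine len_eq_of_pow hk0 ?_ ?_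
  · rw [mul_swap_pow_self_split hk hy hk0 le_rfl, hy]
  · intro t h0 ht h
    rw [mul_swap_pow_self_split hk hy h0 ht.le, ← hy, pow_inj (by omega) (by omega)] at h
    omega

/-- The piece containing `y` consists of `f x, …, f ^ k x = y`. Exponents run from 1 to `len f x`,
so that `x` itself is the last point and not the one with exponent 0. -/
theorem sameCycle_mul_swap_split_right (hk0 : 0 < k) (hk : k < len f x) (hy : (f ^ k) x = y) {p : ℕ}
    (hp0 : 0 < p) (hp : p ≤ len f x) : (f * swap x y).SameCycle y ((f ^ p) x) ↔ p ≤ k := by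
  constructor
  · intro h
    obtain ⟨t, ht, h⟩ := exists_pow_of_sameCycle h
    rw [len_mul_swap_split_right hk0 hk hy] at ht
    rcases Nat.eq_zero_or_pos t with rfl | h0
    · simp only [pow_zero, Perm.one_apply] at h
      rcases hp.lt_or_eq with hp | rfl
      · rw [← hy, pow_inj hk hp] at h
        exact h.ge
      · rw [pow_len] at h
        exact absurd (hy.trans h) (pow_ne_self hk0 hk)
    · rw [mul_swap_pow_self_split hk hy h0 ht.le] at h
      rcases hp.lt_or_eq with hp | rfl
      · rw [pow_inj (by omega) hp] at h
        omega
      · rw [pow_len] at h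
        exact absurd h (pow_ne_self h0 (by omega))
  · intro h
    rw [← mul_swap_pow_self_split hk hy hp0 h]
    exact sameCycle_pow _

theorem not_sameCycle_mul_swap_split (hk0 : 0 < k) (hk : k < len f x) (hy : (f ^ k) x = y) :
    ¬(f * swap x y).SameCycle x y := by
  intro h
  have := (sameCycle_mul_swap_split_right hk0 hk hy len_pos le_rfl).1 (by
    rw [pow_len]
    exact h.symm)
  omega

theorem cyc_mul_swap_split (hk0 : 0 < k) (hk : k < len f x) (hy : (f ^ k) x = y) :
    cyc f x = cyc (f * swap x y) x ∪ cyc (f * swap x y) y := by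
  have := cyc_mul_swap_left (not_sameCycle_mul_swap_split hk0 hk hy)
  rwa [mul_assoc, swap_mul_self, mul_one] at this

theorem len_mul_swap_split_left (hk0 : 0 < k) (hk : k < len f x) (hy : (f ^ k) x = y) :
    len (f * swap x y) x = len f x - k := by
  have := len_mul_swap_left (not_sameCycle_mul_swap_split hk0 hk hy)
  rw [mul_assoc, swap_mul_self, mul_one, len_mul_swap_split_right hk0 hk hy] at this
  omega

theorem lens_mul_swap_split (hk0 : 0 < k) (hk : k < len f x) (hy : (f ^ k) x = y) :
    lens (f * swap x y) + {len f x} = lens f + {len f x - k, k} := by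
  have := lens_mul_swap_of_not_sameCycle_mul_swap (not_sameCycle_mul_swap_split hk0 hk hy)
  rw [len_mul_swap_split_right hk0 hk hy, len_mul_swap_split_left hk0 hk hy,
    Nat.sub_add_cancel hk.le] at this
  exact this.symm

theorem sameCycle_of_mul_swap_split (h : f.SameCycle x y) (hne : x ≠ y)
    (huv : (f * swap x y).SameCycle u v) : f.SameCycle u v := by
  obtain ⟨k, hk0, hk, hy⟩ := exists_pow_of_sameCycle_of_ne h hne
  have := sameCycle_mul_swap_of_sameCycle (not_sameCycle_mul_swap_split hk0 hk hy) huv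
  rwa [mul_assoc, swap_mul_self, mul_one] at this

theorem not_sameCycle_mul_swap (h : f.SameCycle x y) (hne : x ≠ y) :
    ¬(f * swap x y).SameCycle x y := by
  obtain ⟨k, hk0, hk, hy⟩ := exists_pow_of_sameCycle_of_ne h hne
  exact not_sameCycle_mul_swap_split hk0 hk hy

theorem card_lens_mul_swap_of_not_sameCycle (h : ¬f.SameCycle x y) :
    (lens (f * swap x y)).card + 1 = (lens f).card := by
  have := congrArg Multiset.card (lens_mul_swap h)
  simp only [Multiset.card_add, Multiset.insert_eq_cons, Multiset.card_cons,
    Multiset.card_singleton] at this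
  omega

theorem card_lens_mul_swap_of_sameCycle (h : f.SameCycle x y) (hne : x ≠ y) :
    (lens (f * swap x y)).card = (lens f).card + 1 := by
  obtain ⟨k, hk0, hk, hy⟩ := exists_pow_of_sameCycle_of_ne h hne
  have := congrArg Multiset.card (lens_mul_swap_split hk0 hk hy)
  simp only [Multiset.card_add, Multiset.insert_eq_cons, Multiset.card_cons,
    Multiset.card_singleton] at this
  omega

end Swap

/-! ### When two transpositions together preserve the cycle lengths -/

theorem pair_eq_pair_iff {a b c d : ℕ} :
    ({a, b} : Multiset ℕ) = {c, d} ↔ a = c ∧ b = d ∨ a = d ∧ b = c := by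
  constructor
  · intro h
    simp only [Multiset.insert_eq_cons, Multiset.cons_eq_cons, Multiset.singleton_inj,
      Multiset.singleton_eq_cons_iff] at h
    rcases h with h | ⟨-, cs, h1, h2⟩
    · exact Or.inl h
    · rcases h1 with ⟨rfl, rfl⟩
      exact Or.inr ⟨h2.1.symm, rfl⟩
  · rintro (⟨rfl, rfl⟩ | ⟨rfl, rfl⟩)
    · rfl
    · exact Multiset.pair_comm _ _

/-- Multiplying `f` by the transpositions of `a, b` and of `c, d` preserves the cycle lengths. -/
def Good {n : ℕ} (f : Perm (Fin n)) (a b c d : Fin n) : Prop :=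
  lens (f * swap a b * swap c d) = lens f

section Good

variable {n : ℕ} {f : Perm (Fin n)} {a b c d : Fin n}

theorem swap_mul_swap_comm (hac : a ≠ c) (had : a ≠ d) (hbc : b ≠ c) (hbd : b ≠ d) :
    swap a b * swap c d = swap c d * swap a b := by
  have hd : Perm.Disjoint (swap a b) (swap c d) := by
    intro z
    by_cases ha : z = a
    · subst ha
      exact Or.inr (swap_apply_of_ne_of_ne hac had)
    by_cases hb : z = b
    · subst hb
      exact Or.inr (swap_apply_of_ne_of_ne hbc hbd)
    exact Or.inl (swap_apply_of_ne_of_ne ha hb)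
  exact hd.commute

theorem good_swap_left : Good f b a c d ↔ Good f a b c d := by
  rw [Good, swap_comm]; rfl

theorem good_swap_right : Good f a b d c ↔ Good f a b c d := by
  rw [Good, swap_comm d]; rfl

theorem good_swap_pairs (hac : a ≠ c) (had : a ≠ d) (hbc : b ≠ c) (hbd : b ≠ d) :
    Good f c d a b ↔ Good f a b c d := by
  rw [Good, Good, mul_assoc, ← swap_mul_swap_comm hac had hbc hbd, mul_assoc]

/-- The cycle of `d` is untouched by the first join, so the second transposition joins as well and
the number of cycles drops by two. -/
theorem not_good_of_isolated (hab : ¬f.SameCycle a b) (ha : ¬f.SameCycle a d)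
    (hb : ¬f.SameCycle b d) (hc : ¬f.SameCycle c d) : ¬Good f a b c d := by
  have h1 : ¬(f * swap a b).SameCycle c d := by
    intro h
    have h2 := mem_cyc.2 h.symm
    rw [cyc_mul_swap_of_not_sameCycle ha hb, mem_cyc] at h2
    exact hc h2.symm
  intro h
  have := card_lens_mul_swap_of_not_sameCycle hab
  have := card_lens_mul_swap_of_not_sameCycle h1
  rw [Good] at h
  rw [h] at this
  omega

/-- Both transpositions cut, so the number of cycles rises by two. -/
theorem not_good_of_split_split (hab : f.SameCycle a b) (hcd : f.SameCycle c d)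
    (hac : ¬f.SameCycle a c) (hab' : a ≠ b) (hcd' : c ≠ d) : ¬Good f a b c d := by
  have h1 : (f * swap a b).SameCycle c d := by
    rw [← mem_cyc, cyc_mul_swap_of_not_sameCycle hac fun h => hac (hab.trans h), mem_cyc]
    exact hcd
  intro h
  have := card_lens_mul_swap_of_sameCycle hab hab'
  have := card_lens_mul_swap_of_sameCycle h1 hcd'
  rw [Good] at h
  rw [h] at this
  omega

/-- The lengths of the cycles of `a`, `b`, `c` are replaced by `len f a + len f b`, `len f c - k`
and `k`; the two triples must agree as multisets. -/
theorem good_iff_of_isolated_isolated {k : ℕ} (hab : ¬f.SameCycle a b) (hac : ¬f.SameCycle a c)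
    (hbc : ¬f.SameCycle b c) (hk0 : 0 < k) (hk : k < len f c) (hd : (f ^ k) c = d) :
    Good f a b c d ↔ len f c = len f a + len f b ∧ (k = len f a ∨ k = len f b) := by
  have hl := len_mul_swap_of_not_sameCycle hac hbc
  have h1 := lens_mul_swap hab
  have h2 : lens (f * swap a b * swap c d) + {len f c} =
      lens (f * swap a b) + {len f c - k, k} := by
    have := lens_mul_swap_split (f := f * swap a b) (x := c) (y := d) hk0 (by rwa [hl])
      (by rw [mul_swap_pow_of_not_sameCycle hac hbc, hd])
    rwa [hl] at this
  have h3 : lens (f * swap a b * swap c d) + ({len f c} + {len f a, len f b}) =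
      lens f + ({len f a + len f b} + {len f c - k, k}) := by
    rw [← add_assoc, h2, add_right_comm, h1, add_assoc]
  have hpa := len_pos (f := f) (x := a)
  have hpb := len_pos (f := f) (x := b)
  rw [Good]
  constructor
  · intro h
    rw [h] at h3
    have h4 := add_left_cancel h3
    -- The sum of two positive lengths exceeds both, so among the three old lengths it can only be
    -- `len f c`.
    have h5 : len f a + len f b ∈ ({len f c} + {len f a, len f b} : Multiset ℕ) := by
      rw [h4]
      simp
    simp only [Multiset.singleton_add, Multiset.insert_eq_cons, Multiset.mem_cons,
      Multiset.mem_singleton] at h5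
    have h6 : len f c = len f a + len f b := by omega
    refine ⟨h6, ?_⟩
    rw [h6] at h4
    have h7 := pair_eq_pair_iff.1 (add_left_cancel h4)
    omega
  · rintro ⟨h4, h5⟩
    rw [h4] at h3
    have h6 : ({len f a, len f b} : Multiset ℕ) = {len f a + len f b - k, k} :=
      pair_eq_pair_iff.2 (by omega)
    rw [← h6] at h3
    exact add_right_cancel h3

/-- The first transposition concatenates the two cycles and the second cuts the result. The cut must
give back the two old lengths, in either order, whence the two alternatives. -/
theorem good_iff_of_pair_pair {p q : ℕ} (hac : ¬f.SameCycle a c) (hq0 : 0 < q) (hq : q < len f a)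
    (hb : (f ^ q) a = b) (hp0 : 0 < p) (hp : p < len f c) (hd : (f ^ p) c = d) :
    Good f a c b d ↔ p = q ∨ p + len f a = q + len f c := by
  have h1 := lens_mul_swap hac
  have hb' : ((f * swap a c) ^ q) c = b := by
    rw [mul_swap_pow_right_of_not_sameCycle hac hq0 hq.le, hb]
  -- Starting from `c`, the joined cycle runs through the old cycle of `a` from `f a` to `a` and
  -- then through that of `c` from `f c` on. So `b` has position `q` and `d` has position `len f a +
  -- p`.
  have hd' : ((f * swap a c) ^ (len f a + p - q)) b = d := by
    rw [← hb', ← Perm.mul_apply, ← pow_add, Nat.sub_add_cancel (by omega), add_comm, pow_add,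
      Perm.mul_apply, mul_swap_pow_right_of_not_sameCycle hac len_pos le_rfl, pow_len,
      mul_swap_pow_left_of_not_sameCycle hac hp0 hp.le, hd]
  have hl : len (f * swap a c) b = len f a + len f c := by
    rw [← len_mul_swap_left hac]
    exact (len_eq (sameCycle_mul_swap_of_sameCycle_left hac ⟨q, by simpa using hb⟩)).symm
  have h2 := lens_mul_swap_split (f := f * swap a c) (x := b) (y := d) (by omega)
    (by rw [hl]; omega) hd'
  rw [hl] at h2
  have h3 : lens (f * swap a c * swap b d) + {len f a, len f c} + {len f a + len f c} =
      lens f + {len f a + len f c - (len f a + p - q), len f a + p - q} +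
        {len f a + len f c} := by
    rw [add_right_comm, h2, add_right_comm, h1, add_right_comm]
  have h4 := add_right_cancel h3
  rw [Good]
  constructor
  · intro h
    rw [h] at h4
    have h5 := pair_eq_pair_iff.1 (add_left_cancel h4)
    omega
  · intro h
    have h5 : ({len f a, len f c} : Multiset ℕ) =
        {len f a + len f c - (len f a + p - q), len f a + p - q} :=
      pair_eq_pair_iff.2 (by omega)
    rw [← h5] at h4
    exact add_right_cancel h4

/-- The two transpositions commute, so the cut at `c, d` may come first. It detaches a piece of
length `q - p` that does not contain `b`; the rest is then joined to the cycle of `a`. Since `q - p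
< len f b`, the detached piece must replace the cycle of `a`. -/
theorem good_iff_of_isolated_left {p q : ℕ} (hab : ¬f.SameCycle a b) (hp0 : 0 < p) (hpq : p < q)
    (hq : q < len f b) (hc : (f ^ p) b = c) (hd : (f ^ q) b = d) :
    Good f a b c d ↔ q = p + len f a := by
  have hbc : f.SameCycle b c := hc ▸ sameCycle_pow p
  have hbd : f.SameCycle b d := hd ▸ sameCycle_pow q
  have hac : ¬f.SameCycle a c := fun h => hab (h.trans hbc.symm)
  have had : ¬f.SameCycle a d := fun h => hab (h.trans hbd.symm)
  have hl := len_eq hbc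
  have hd' : (f ^ (q - p)) c = d := by
    rw [← hc, ← Perm.mul_apply, ← pow_add, Nat.sub_add_cancel hpq.le, hd]
  have hb' : (f ^ (len f b - p)) c = b := by
    rw [← hc, ← Perm.mul_apply, ← pow_add, Nat.sub_add_cancel (by omega), pow_len]
  have hne : c ≠ d := by
    rintro rfl
    exact pow_ne_self (by omega) (by omega) hd'
  have h1 := lens_mul_swap_split (f := f) (x := c) (y := d) (by omega) (by omega) hd'
  have h2 : ¬(f * swap c d).SameCycle d b := by
    have := sameCycle_mul_swap_split_right (f := f) (x := c) (y := d) (k := q - p)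
      (p := len f b - p) (by omega) (by omega) hd' (by omega) (by omega)
    rw [hb'] at this
    rw [this]
    omega
  have h3 : (f * swap c d).SameCycle c b := by
    have h4 : b ∈ cyc f c := mem_cyc.2 hbc.symm
    rw [cyc_mul_swap_split (by omega) (by omega) hd', Finset.mem_union, mem_cyc, mem_cyc] at h4
    tauto
  have hlb : len (f * swap c d) b = len f b - (q - p) := by
    rw [← len_eq h3, len_mul_swap_split_left (by omega) (by omega) hd', hl]
  have hla : len (f * swap c d) a = len f a :=
    len_mul_swap_of_not_sameCycle (fun h => hac h.symm) fun h => had h.symm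
  have h4 : ¬(f * swap c d).SameCycle a b := fun h =>
    hab (sameCycle_of_mul_swap_split (hbc.symm.trans hbd) hne h)
  have h5 := lens_mul_swap h4
  rw [hlb, hla] at h5
  rw [← hl] at h1
  have h6 : lens (f * swap c d * swap a b) + {len f a, len f b} + {len f b - (q - p)} =
      lens f + {q - p, len f a + (len f b - (q - p))} + {len f b - (q - p)} := by
    have : ({len f a, len f b} + {len f b - (q - p)} : Multiset ℕ) =
        {len f a, len f b - (q - p)} + {len f b} := by
      ext i
      simp only [Multiset.count_add, Multiset.insert_eq_cons, Multiset.count_cons,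
        Multiset.count_singleton]
      omega
    rw [add_assoc, this, ← add_assoc, h5, add_right_comm, h1, add_assoc, add_assoc]
    congr 1
    ext i
    simp only [Multiset.count_add, Multiset.insert_eq_cons, Multiset.count_cons,
      Multiset.count_singleton]
    omega
  have h7 := add_right_cancel h6
  have hac' : a ≠ c := fun h => hac (h ▸ SameCycle.refl _ _)
  have had' : a ≠ d := fun h => had (h ▸ SameCycle.refl _ _)
  have hbc' : b ≠ c := fun h => pow_ne_self hp0 (by omega) (hc.trans h.symm)
  have hbd' : b ≠ d := fun h => pow_ne_self (by omega) hq (hd.trans h.symm)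
  rw [← good_swap_pairs hac' had' hbc' hbd', Good]
  constructor
  · intro h
    rw [h] at h7
    have h8 := pair_eq_pair_iff.1 (add_left_cancel h7)
    omega
  · intro h
    have h8 : ({len f a, len f b} : Multiset ℕ) = {q - p, len f a + (len f b - (q - p))} :=
      pair_eq_pair_iff.2 (by omega)
    rw [← h8] at h7
    exact add_right_cancel h7

/-- The first transposition cuts the common cycle, so the second must reunite the two halves, and
doing so restores the length automatically. Geometrically, the chords `ab` and `cd` cross. -/
theorem good_iff_of_sameCycle (hab : f.SameCycle a b) (hac : f.SameCycle a c)
    (had : f.SameCycle a d) (hab' : a ≠ b) (hcd' : c ≠ d) :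
    Good f a b c d ↔ c ∈ cyc (f * swap a b) a ∧ d ∈ cyc (f * swap a b) b ∨
      c ∈ cyc (f * swap a b) b ∧ d ∈ cyc (f * swap a b) a := by
  obtain ⟨k, hk0, hk, hb⟩ := exists_pow_of_sameCycle_of_ne hab hab'
  have h1 := lens_mul_swap_split hk0 hk hb
  have hU := cyc_mul_swap_split hk0 hk hb
  have hN := not_sameCycle_mul_swap hab hab'
  have hc : c ∈ cyc f a := mem_cyc.2 hac
  have hd : d ∈ cyc f a := mem_cyc.2 had
  have hla := len_mul_swap_split_left hk0 hk hb
  have hlb := len_mul_swap_split_right hk0 hk hb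
  have key : ∀ u v, (f * swap a b).SameCycle a u → (f * swap a b).SameCycle b v →
      Good f a b u v := by
    intro u v hu hv
    have h2 := lens_mul_swap (f := f * swap a b) (x := u) (y := v)
      fun h => hN ((hu.trans h).trans hv.symm)
    rw [← len_eq hu, ← len_eq hv, hla, hlb, Nat.sub_add_cancel hk.le, h1] at h2
    exact add_right_cancel h2
  simp only [mem_cyc]
  constructor
  · intro h
    have hn : ¬(f * swap a b).SameCycle c d := by
      intro h2
      have h3 := card_lens_mul_swap_of_sameCycle h2 hcd'
      have h4 := card_lens_mul_swap_of_sameCycle hab hab'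
      rw [Good] at h
      rw [h] at h3
      omega
    rw [hU, Finset.mem_union, mem_cyc, mem_cyc] at hc hd
    rcases hc with hc | hc <;> rcases hd with hd | hd
    · exact absurd (hc.symm.trans hd) hn
    · exact Or.inl ⟨hc, hd⟩
    · exact Or.inr ⟨hc, hd⟩
    · exact absurd (hc.symm.trans hd) hn
  · rintro (⟨hc, hd⟩ | ⟨hc, hd⟩)
    · exact key c d hc hd
    · exact good_swap_right.1 (key d c hd hc)

end Good

/-! ### Conjugacy, cycle lengths and the centralizer factor -/

section Conjugacy

variable {n : ℕ} {f g : Perm (Fin n)}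

theorem cyc_eq_support_cycleOf {x : Fin n} (hx : x ∈ f.support) :
    cyc f x = (f.cycleOf x).support := by
  ext y
  rw [mem_cyc, mem_support_cycleOf_iff]
  exact ⟨fun h => ⟨h, hx⟩, fun h => h.1⟩

theorem cyc_eq_singleton {x : Fin n} (hx : x ∉ f.support) : cyc f x = {x} := by
  ext y
  rw [mem_cyc, Finset.mem_singleton]
  constructor
  · intro h
    exact (h.eq_of_left (Equiv.Perm.notMem_support.1 hx)).symm
  · rintro rfl
    exact SameCycle.refl _ _

theorem support_injOn_cycleFactorsFinset :
    Set.InjOn Perm.support (f.cycleFactorsFinset : Set (Perm (Fin n))) := by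
  intro c hc d hd h
  by_contra hne
  have h1 := (cycleFactorsFinset_pairwise_disjoint f hc hd hne).disjoint_support
  rw [h, disjoint_self, Finset.bot_eq_empty, support_eq_empty_iff] at h1
  exact (mem_cycleFactorsFinset_iff.1 hd).1.ne_one h1

theorem lens_eq_cycleType_add (f : Perm (Fin n)) :
    lens f = f.cycleType + Multiset.replicate (f.supportᶜ.card) 1 := by
  have h1 : cycles f = f.cycleFactorsFinset.image Perm.support ∪
      f.supportᶜ.image fun x => {x} := by
    ext s
    simp only [Finset.mem_union, Finset.mem_image, mem_cycles, Finset.mem_compl]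
    constructor
    · rintro ⟨x, rfl⟩
      by_cases hx : x ∈ f.support
      · exact Or.inl ⟨_, cycleOf_mem_cycleFactorsFinset_iff.2 hx, (cyc_eq_support_cycleOf hx).symm⟩
      · exact Or.inr ⟨x, hx, (cyc_eq_singleton hx).symm⟩
    · rintro (⟨c, hc, rfl⟩ | ⟨x, hx, rfl⟩)
      · obtain ⟨x, hx⟩ := (mem_cycleFactorsFinset_iff.1 hc).1.nonempty_support
        refine ⟨x, ?_⟩
        rw [cyc_eq_support_cycleOf (mem_cycleFactorsFinset_support_le hc hx),
          cycle_is_cycleOf hx hc]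
      · exact ⟨x, cyc_eq_singleton hx⟩
  have h2 : Disjoint (f.cycleFactorsFinset.image Perm.support)
      (f.supportᶜ.image fun x => ({x} : Finset (Fin n))) := by
    rw [Finset.disjoint_left]
    intro s hs ht
    obtain ⟨c, hc, rfl⟩ := Finset.mem_image.1 hs
    obtain ⟨x, -, hx⟩ := Finset.mem_image.1 ht
    have := (mem_cycleFactorsFinset_iff.1 hc).1.two_le_card_support
    rw [← hx] at this
    simp at this
  rw [lens, h1, ← Finset.disjUnion_eq_union _ _ h2, Finset.disjUnion_val, Multiset.map_add,
    Finset.image_val_of_injOn support_injOn_cycleFactorsFinset,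
    Finset.image_val_of_injOn (Finset.singleton_injective.injOn), cycleType_def,
    Multiset.map_map, Multiset.map_map]
  simp

theorem isConj_iff_lens_eq : IsConj f g ↔ lens f = lens g := by
  rw [isConj_iff_cycleType_eq]
  constructor
  · intro h
    rw [lens_eq_cycleType_add, lens_eq_cycleType_add, h, Finset.card_compl, Finset.card_compl,
      ← sum_cycleType, ← sum_cycleType, h]
  · intro h
    have key : ∀ f : Perm (Fin n), (lens f).filter (fun k => 2 ≤ k) = f.cycleType := by
      intro f
      rw [lens_eq_cycleType_add, Multiset.filter_add,
        Multiset.filter_eq_self.2 fun k hk => two_le_of_mem_cycleType hk,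
        Multiset.filter_eq_nil.2, add_zero]
      intro k hk
      rw [Multiset.eq_of_mem_replicate hk]
      norm_num
    rw [← key f, ← key g, h]

open scoped Classical in
theorem card_filter_conj (P : Perm (Fin n) → Prop) :
    (Finset.univ.filter fun a : Perm (Fin n) => P (a⁻¹ * f * a)).card =
      centralizerOrder f * (Finset.univ.filter fun g => IsConj f g ∧ P g).card := by
  rw [Finset.card_eq_sum_card_fiberwise (f := fun a => a⁻¹ * f * a)
    (t := Finset.univ.filter fun g => IsConj f g ∧ P g), Finset.sum_const_nat, mul_comm]
  · intro g hg
    obtain ⟨⟨c, hc⟩, hP⟩ := (Finset.mem_filter.1 hg).2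
    rw [SemiconjBy] at hc
    have hc' : (c : Perm (Fin n))⁻¹ * g * c = f := by
      rw [mul_assoc, ← hc, inv_mul_cancel_left]
    rw [centralizerOrder, Nat.card_eq_fintype_card, Fintype.card_subtype]
    -- With `c * f = g * c`, right multiplication by `c` carries the fibre over `g` onto the
    -- centralizer of `f`.
    refine Finset.card_nbij' (fun a => a * c) (fun a => a * (c : Perm (Fin n))⁻¹) ?_ ?_ ?_ ?_
    · intro a ha
      simp only [Finset.coe_filter, Set.mem_ofPred_eq, Finset.mem_filter, Finset.mem_univ,
        true_and] at ha ⊢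
      rw [Subgroup.mem_centralizer_singleton_iff]
      have h1 : f * a = a * g := by rw [← ha.2]; group
      rw [mul_assoc, hc, ← mul_assoc, ← h1, mul_assoc]
    · intro a ha
      simp only [Finset.coe_filter, Set.mem_ofPred_eq, Finset.mem_filter, Finset.mem_univ,
        true_and] at ha ⊢
      rw [Subgroup.mem_centralizer_singleton_iff] at ha
      have h1 : (a * (c : Perm (Fin n))⁻¹)⁻¹ * f * (a * (c : Perm (Fin n))⁻¹) = g := by
        have h2 : a⁻¹ * (f * a) = f := by rw [← ha, inv_mul_cancel_left]
        have h3 : (c : Perm (Fin n)) * f * (c : Perm (Fin n))⁻¹ = g := by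
          rw [hc, mul_inv_cancel_right]
        rw [← h3]
        nth_rewrite 2 [← h2]
        group
      exact ⟨h1 ▸ hP, h1⟩
    · intro a _
      simp
    · intro a _
      simp
  · intro a ha
    simp only [Finset.coe_filter, Set.mem_ofPred_eq, Finset.mem_univ, true_and] at ha ⊢
    refine ⟨isConj_iff.2 ⟨a⁻¹, by simp⟩, ha⟩

end Conjugacy

/-- The multiset of the positive numbers of points of `S` in the cycles of `f`. -/
def typ {n : ℕ} (f : Perm (Fin n)) (S : Finset (Fin n)) : Multiset ℕ :=
  ((cycles f).filter fun s => (s ∩ S).card ≠ 0).val.map fun s => (s ∩ S).card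

open scoped Classical in
/-- The number of quadruples satisfying `P`. -/
noncomputable def quad {n : ℕ} (P : Fin n → Fin n → Fin n → Fin n → Prop) : ℕ :=
  ∑ a, ∑ b, ∑ c, ∑ d, if P a b c d then 1 else 0

/-- The four points are pairwise distinct. -/
def Distinct {n : ℕ} (a b c d : Fin n) : Prop :=
  a ≠ b ∧ a ≠ c ∧ a ≠ d ∧ b ≠ c ∧ b ≠ d ∧ c ≠ d

theorem eq_of_sum_eq_four {m : Multiset ℕ} (hm : ∀ k ∈ m, 0 < k) (hs : m.sum = 4) :
    m = {4} ∨ m = {3, 1} ∨ m = {2, 2} ∨ m = {2, 1, 1} ∨ m = {1, 1, 1, 1} := by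
  induction m using Quotient.inductionOn with
  | h l =>
    simp only [Multiset.quot_mk_to_coe, Multiset.mem_coe, Multiset.sum_coe] at hm hs ⊢
    rcases l with _ | ⟨a, _ | ⟨b, _ | ⟨c, _ | ⟨d, _ | ⟨e, l⟩⟩⟩⟩⟩ <;>
      simp only [List.mem_cons, List.not_mem_nil, or_false, forall_eq_or_imp, forall_eq,
        List.sum_cons, List.sum_nil] at hm hs
    · omega
    · obtain rfl : a = 4 := by omega
      decide
    · have : a < 4 := by omega
      obtain rfl : b = 4 - a := by omega
      interval_cases a <;> first | omega | decide
    · have : a < 3 := by omega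
      have : b < 3 := by omega
      obtain rfl : c = 4 - a - b := by omega
      interval_cases a <;> interval_cases b <;> first | omega | decide
    · obtain rfl : a = 1 := by omega
      obtain rfl : b = 1 := by omega
      obtain rfl : c = 1 := by omega
      obtain rfl : d = 1 := by omega
      decide
    · omega

/-! ### Distribution of four points among the cycles -/

section Typ

variable {n : ℕ} {f : Perm (Fin n)}

theorem sum_card_inter (S : Finset (Fin n)) (g : Fin n → ℕ) :
    ∑ s ∈ cycles f, ∑ x ∈ s ∩ S, g x = ∑ x ∈ S, g x := by
  rw [← Finset.sum_fiberwise_of_maps_to (s := S) (t := cycles f) (g := cyc f)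
    fun _ _ => cyc_mem_cycles]
  refine Finset.sum_congr rfl fun s hs => Finset.sum_congr ?_ fun _ _ => rfl
  ext x
  simp only [Finset.mem_inter, Finset.mem_filter]
  constructor
  · rintro ⟨h1, h2⟩
    exact ⟨h2, (eq_cyc_of_mem hs h1).symm⟩
  · rintro ⟨h1, rfl⟩
    exact ⟨self_mem_cyc, h1⟩

theorem sum_map_typ (S : Finset (Fin n)) (g : ℕ → ℕ) (hg : g 0 = 0) :
    ((typ f S).map g).sum = ∑ s ∈ cycles f, g (s ∩ S).card := by
  rw [typ, Multiset.map_map]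
  change ∑ s ∈ (cycles f).filter (fun s => (s ∩ S).card ≠ 0), g (s ∩ S).card = _
  refine Finset.sum_filter_of_ne fun s _ h h0 => h ?_
  rw [h0, hg]

theorem sum_typ (S : Finset (Fin n)) : (typ f S).sum = S.card := by
  have h1 := sum_map_typ (f := f) S id rfl
  rw [Multiset.map_id] at h1
  have h2 := sum_card_inter (f := f) S fun _ => 1
  simp only [Finset.sum_const, smul_eq_mul, mul_one] at h2
  rw [h1, ← h2]
  rfl

theorem pos_of_mem_typ {S : Finset (Fin n)} {k : ℕ} (hk : k ∈ typ f S) : 0 < k := by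
  obtain ⟨s, hs, rfl⟩ := Multiset.mem_map.1 hk
  exact Nat.pos_of_ne_zero (Finset.mem_filter (s := cycles f).1 hs).2

/-- Both sides count ordered pairs of points of `S` lying in a common cycle. -/
theorem sum_sq_typ (S : Finset (Fin n)) :
    ((typ f S).map fun k => k ^ 2).sum = ∑ x ∈ S, ∑ y ∈ S, if f.SameCycle x y then 1 else 0 := by
  rw [sum_map_typ S (fun k => k ^ 2) rfl, ← sum_card_inter (f := f) S]
  refine Finset.sum_congr rfl fun s hs => ?_
  rw [pow_two, ← smul_eq_mul, ← Finset.sum_const]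
  refine Finset.sum_congr rfl fun x hx => ?_
  rw [← Finset.card_filter]
  congr 1
  ext y
  rw [Finset.mem_inter, Finset.mem_filter, and_comm,
    eq_cyc_of_mem hs (Finset.mem_inter.1 hx).1, mem_cyc]

theorem typ_cases {S : Finset (Fin n)} (hS : S.card = 4) :
    typ f S = {4} ∨ typ f S = {3, 1} ∨ typ f S = {2, 2} ∨ typ f S = {2, 1, 1} ∨
      typ f S = {1, 1, 1, 1} :=
  eq_of_sum_eq_four (fun _ hk => pos_of_mem_typ hk) (by rw [sum_typ, hS])

/-- The five partitions of 4 have distinct sums of squares, so the number of ordered pairs in a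
common cycle determines the type. -/
theorem typ_eq_iff {S : Finset (Fin n)} (hS : S.card = 4) :
    let q := ∑ x ∈ S, ∑ y ∈ S, if f.SameCycle x y then 1 else 0
    (typ f S = {4} ↔ q = 16) ∧ (typ f S = {3, 1} ↔ q = 10) ∧ (typ f S = {2, 2} ↔ q = 8) ∧
      (typ f S = {2, 1, 1} ↔ q = 6) ∧ (typ f S = {1, 1, 1, 1} ↔ q = 4) := by
  intro q
  have hq : q = ((typ f S).map fun k => k ^ 2).sum := (sum_sq_typ S).symm
  rcases typ_cases (f := f) hS with h | h | h | h | h <;> rw [hq, h] <;> decide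

theorem sum_sameCycle_quad {a b c d : Fin n} (h : Distinct a b c d) :
    (∑ x ∈ ({a, b, c, d} : Finset (Fin n)), ∑ y ∈ ({a, b, c, d} : Finset (Fin n)),
      if f.SameCycle x y then 1 else 0) =
      4 + 2 * ((if f.SameCycle a b then 1 else 0) + (if f.SameCycle a c then 1 else 0) +
        (if f.SameCycle a d then 1 else 0) + (if f.SameCycle b c then 1 else 0) +
        (if f.SameCycle b d then 1 else 0) + (if f.SameCycle c d then 1 else 0)) := by
  obtain ⟨h1, h2, h3, h4, h5, h6⟩ := h
  have hS : ∀ g : Fin n → ℕ, ∑ x ∈ ({a, b, c, d} : Finset (Fin n)), g x =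
      g a + g b + g c + g d := by
    intro g
    rw [Finset.sum_insert, Finset.sum_insert, Finset.sum_insert, Finset.sum_singleton]
    · ring
    all_goals simp [*]
  simp only [hS, SameCycle.refl, if_true, sameCycle_comm (x := b) (y := a),
    sameCycle_comm (x := c) (y := a), sameCycle_comm (x := d) (y := a),
    sameCycle_comm (x := c) (y := b), sameCycle_comm (x := d) (y := b),
    sameCycle_comm (x := d) (y := c)]
  ring

theorem card_quad {a b c d : Fin n} (h : Distinct a b c d) :
    ({a, b, c, d} : Finset (Fin n)).card = 4 := by
  obtain ⟨h1, h2, h3, h4, h5, h6⟩ := h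
  rw [Finset.card_insert_of_notMem, Finset.card_insert_of_notMem, Finset.card_insert_of_notMem,
    Finset.card_singleton]
  all_goals simp [*]

end Typ

/-! ### From commuting defects to perturbations of `f` -/

section Reduction

theorem card_filter_congr {α : Type*} {s : Finset α} {p q : α → Prop} {_ : DecidablePred p}
    {_ : DecidablePred q} (h : ∀ x, p x ↔ q x) : (s.filter p).card = (s.filter q).card :=
  congrArg Finset.card (Finset.filter_congr fun x _ => h x)

variable {n : ℕ} {f : Perm (Fin n)}

theorem mul_apply_ne_iff (a : Perm (Fin n)) (x : Fin n) :
    (a * f) x ≠ (f * a) x ↔ x ∈ (f⁻¹ * (a⁻¹ * f * a)).support := by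
  have h : (f⁻¹ * (a⁻¹ * f * a)) x = x ↔ (a * f) x = (f * a) x := by
    rw [Perm.mul_apply f⁻¹, Perm.inv_eq_iff_eq, mul_assoc, Perm.mul_apply a⁻¹,
      Perm.inv_eq_iff_eq, eq_comm]
    rfl
  rw [mem_support, Ne, Ne, h]

theorem hammingDist_eq_card_support (a : Perm (Fin n)) :
    hammingDist (⇑(a * f)) (⇑(f * a)) = (f⁻¹ * (a⁻¹ * f * a)).support.card := by
  rw [hammingDist]
  congr 1
  ext x
  rw [Finset.mem_filter, mul_apply_ne_iff]
  simp

theorem badCount_eq (a : Perm (Fin n)) (s : Finset (Fin n)) :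
    badCount a f s = (s ∩ (f⁻¹ * (a⁻¹ * f * a)).support).card := by
  rw [badCount]
  congr 1
  ext x
  rw [Finset.mem_filter, mul_apply_ne_iff, Finset.mem_inter]

open scoped Classical in
/-- The number of `p` with `k` moved points such that `f * p` has the cycle lengths of `f` and the
set of moved points of `p` satisfies `Q`. -/
noncomputable def numPerturb (f : Perm (Fin n)) (k : ℕ) (Q : Finset (Fin n) → Prop) : ℕ :=
  (Finset.univ.filter fun p : Perm (Fin n) =>
    p.support.card = k ∧ lens (f * p) = lens f ∧ Q p.support).card

open scoped Classical in
theorem card_filter_eq_mul_numPerturb (k : ℕ) (Q : Finset (Fin n) → Prop) :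
    (Finset.univ.filter fun a : Perm (Fin n) =>
      hammingDist (⇑(a * f)) (⇑(f * a)) = k ∧ Q (f⁻¹ * (a⁻¹ * f * a)).support).card =
      centralizerOrder f * numPerturb f k Q := by
  simp only [hammingDist_eq_card_support]
  have key := card_filter_conj (f := f) fun g =>
    (f⁻¹ * g).support.card = k ∧ Q (f⁻¹ * g).support
  refine Eq.trans (by congr!) (key.trans (congrArg _ ?_))
  refine Finset.card_nbij' (fun g => f⁻¹ * g) (fun p => f * p) ?_ ?_ ?_ ?_
  · intro g hg
    simp only [Finset.coe_filter, Set.mem_ofPred_eq, Finset.mem_univ, true_and] at hg ⊢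
    rw [mul_inv_cancel_left]
    exact ⟨hg.2.1, (isConj_iff_lens_eq.1 hg.1).symm, hg.2.2⟩
  · intro p hp
    simp only [Finset.coe_filter, Set.mem_ofPred_eq, Finset.mem_univ, true_and] at hp ⊢
    rw [inv_mul_cancel_left]
    exact ⟨isConj_iff_lens_eq.2 hp.2.1.symm, hp.1, hp.2.2⟩
  · intro g _
    simp
  · intro p _
    simp

theorem numKCommuting_eq (k : ℕ) :
    numKCommuting k f = centralizerOrder f * numPerturb f k fun _ => True := by
  classical
  rw [← card_filter_eq_mul_numPerturb, numKCommuting, kCommuting]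
  congr 1
  ext a
  simp only [Finset.mem_filter, and_true]

theorem numOfType_eq (m : Multiset ℕ) :
    numOfType m f = centralizerOrder f * numPerturb f m.sum fun S => typ f S = m := by
  rw [numOfType, kCommutingOfType, kCommuting, Finset.filter_filter]
  refine (card_filter_congr fun a => ?_).trans
    (card_filter_eq_mul_numPerturb m.sum fun S => typ f S = m)
  simp only [typ, badCount_eq]

end Reduction

/-! ### Even permutations with four moved points as ordered quadruples -/

section Quad

variable {n : ℕ} {f : Perm (Fin n)}

theorem quad_congr {P Q : Fin n → Fin n → Fin n → Fin n → Prop}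
    (h : ∀ a b c d, P a b c d ↔ Q a b c d) : quad P = quad Q := by
  have : P = Q := by
    ext a b c d
    exact h a b c d
  rw [this]

theorem quad_or {P Q : Fin n → Fin n → Fin n → Fin n → Prop}
    (h : ∀ a b c d, P a b c d → ¬Q a b c d) :
    (quad fun a b c d => P a b c d ∨ Q a b c d) = quad P + quad Q := by
  classical
  simp only [quad, ← Finset.sum_add_distrib]
  refine Finset.sum_congr rfl fun a _ => Finset.sum_congr rfl fun b _ =>
    Finset.sum_congr rfl fun c _ => Finset.sum_congr rfl fun d _ => ?_
  have := h a b c d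
  by_cases h1 : P a b c d <;> by_cases h2 : Q a b c d <;> simp_all

theorem quad_swap_left (P : Fin n → Fin n → Fin n → Fin n → Prop) :
    (quad fun a b c d => P b a c d) = quad P :=
  Finset.sum_comm

theorem quad_swap_middle (P : Fin n → Fin n → Fin n → Fin n → Prop) :
    (quad fun a b c d => P a c b d) = quad P :=
  Finset.sum_congr rfl fun _ _ => Finset.sum_comm

theorem quad_swap_right (P : Fin n → Fin n → Fin n → Fin n → Prop) :
    (quad fun a b c d => P a b d c) = quad P :=
  Finset.sum_congr rfl fun _ _ => Finset.sum_congr rfl fun _ _ => Finset.sum_comm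

theorem quad_swap_pairs (P : Fin n → Fin n → Fin n → Fin n → Prop) :
    (quad fun a b c d => P c d a b) = quad P := by
  rw [← quad_swap_middle fun a b c d => P c d a b, quad_swap_left fun a b c d => P a d b c,
    quad_swap_right fun a b c d => P a c b d, quad_swap_middle]

theorem support_swap_mul_swap {a b c d : Fin n} (h : Distinct a b c d) :
    (swap a b * swap c d).support = {a, b, c, d} := by
  obtain ⟨h1, h2, h3, h4, h5, h6⟩ := h
  ext z
  rw [mem_support, Perm.mul_apply]
  simp only [Finset.mem_insert, Finset.mem_singleton]
  constructor
  · intro hz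
    by_contra! hc
    rw [swap_apply_of_ne_of_ne hc.2.2.1 hc.2.2.2, swap_apply_of_ne_of_ne hc.1 hc.2.1] at hz
    exact hz rfl
  · rintro (rfl | rfl | rfl | rfl)
    · rw [swap_apply_of_ne_of_ne h2 h3, swap_apply_left]
      exact h1.symm
    · rw [swap_apply_of_ne_of_ne h4 h5, swap_apply_right]
      exact h1
    · rw [swap_apply_left, swap_apply_of_ne_of_ne h3.symm h5.symm]
      exact h6.symm
    · rw [swap_apply_right, swap_apply_of_ne_of_ne h2.symm h4.symm]
      exact h6

/-- Among cycle types without parts 1 and of sum 4, `{4}` is odd, which leaves `{2, 2}`. -/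
theorem apply_apply_of_even {p : Perm (Fin n)} (hp : p.support.card = 4) (hs : sign p = 1)
    (x : Fin n) : p (p x) = x := by
  have h2 : ∀ k ∈ p.cycleType, 2 ≤ k := fun k hk => two_le_of_mem_cycleType hk
  have hs' := sign_of_cycleType p
  rw [hs] at hs'
  have h1 : p.cycleType = {2, 2} := by
    rcases eq_of_sum_eq_four (fun k hk => two_pos.trans_le (h2 k hk)) (by rw [sum_cycleType, hp])
      with h | h | h | h | h <;> rw [h] at h2 hs' ⊢ <;> revert h2 hs' <;> decide
  have h3 : p ^ 2 = 1 := by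
    rw [← orderOf_dvd_iff_pow_eq_one, ← lcm_cycleType, h1]
    decide
  rw [← Perm.mul_apply, ← pow_two, h3, Perm.one_apply]

open scoped Classical in
theorem quad_swap_mul_swap (G : Perm (Fin n) → Prop)
    (hG : ∀ p, G p → sign p = 1) :
    (quad fun a b c d => Distinct a b c d ∧ G (swap a b * swap c d)) =
      8 * (Finset.univ.filter fun p : Perm (Fin n) => p.support.card = 4 ∧ G p).card := by
  have h1 : (quad fun a b c d : Fin n => Distinct a b c d ∧ G (swap a b * swap c d)) =
      (Finset.univ.filter fun t : Fin n × Fin n × Fin n × Fin n =>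
        Distinct t.1 t.2.1 t.2.2.1 t.2.2.2 ∧ G (swap t.1 t.2.1 * swap t.2.2.1 t.2.2.2)).card := by
    rw [Finset.card_filter]
    simp only [Fintype.sum_prod_type]
    refine Finset.sum_congr rfl fun a _ => Finset.sum_congr rfl fun b _ =>
      Finset.sum_congr rfl fun c _ => Finset.sum_congr rfl fun d _ => ?_
    congr
  rw [h1, Finset.card_eq_sum_card_fiberwise
    (f := fun t : Fin n × Fin n × Fin n × Fin n => swap t.1 t.2.1 * swap t.2.2.1 t.2.2.2)
    (t := Finset.univ.filter fun p : Perm (Fin n) => p.support.card = 4 ∧ G p),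
    Finset.sum_const_nat, mul_comm]
  · intro p hp
    obtain ⟨hp4, hGp⟩ := (Finset.mem_filter.1 hp).2
    have hpp := apply_apply_of_even hp4 (hG p hGp)
    -- A quadruple is determined by `a` and `c`, as `b = p a` and `d = p c`: four choices for `a`,
    -- then two for `c` outside `{a, p a}`.
    have h8 : (p.support.sigma fun x => p.support \ {x, p x}).card = 8 := by
      rw [Finset.card_sigma, Finset.sum_const_nat (m := 2), hp4]
      intro x hx
      rw [Finset.card_sdiff_of_subset, hp4, Finset.card_pair]
      · exact (mem_support.1 hx).symm
      · intro z hz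
        rcases Finset.mem_insert.1 hz with rfl | hz
        · exact hx
        · rw [Finset.mem_singleton.1 hz]
          exact apply_mem_support.2 hx
    rw [← h8]
    refine Finset.card_nbij' (fun t => ⟨t.1, t.2.2.1⟩)
      (fun s => (s.1, p s.1, s.2, p s.2)) ?_ ?_ ?_ ?_
    · rintro ⟨a, b, c, d⟩ ht
      simp only [Finset.coe_filter, Set.mem_ofPred_eq, Finset.mem_filter, Finset.mem_univ,
        true_and] at ht
      obtain ⟨⟨hd, -⟩, rfl⟩ := ht
      have hd' := hd
      obtain ⟨h1, h2, h3, h4, h5, h6⟩ := hd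
      simp only [Finset.coe_sigma, Set.mem_sigma_iff, Finset.mem_coe, Finset.mem_sdiff,
        support_swap_mul_swap hd', Finset.mem_insert, Finset.mem_singleton, Perm.mul_apply,
        swap_apply_of_ne_of_ne h2 h3, swap_apply_left]
      refine ⟨by simp, by simp, ?_⟩
      rintro (rfl | rfl)
      · exact h2 rfl
      · exact h4 rfl
    · rintro ⟨a, c⟩ ht
      simp only [Finset.coe_sigma, Set.mem_sigma_iff, Finset.mem_coe, Finset.mem_sdiff,
        Finset.mem_insert, Finset.mem_singleton, not_or] at ht
      obtain ⟨ha, hc, hca, hcb⟩ := ht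
      have hD : Distinct a (p a) c (p c) := by
        refine ⟨(mem_support.1 ha).symm, fun h => hca h.symm, fun h => hcb ?_,
          fun h => hcb h.symm, fun h => hca ?_, (mem_support.1 hc).symm⟩
        · rw [h, hpp]
        · exact (p.injective h).symm
      have hS : ({a, p a, c, p c} : Finset (Fin n)) = p.support := by
        refine Finset.eq_of_subset_of_card_le ?_ (by rw [card_quad hD, hp4])
        intro z hz
        simp only [Finset.mem_insert, Finset.mem_singleton] at hz
        rcases hz with rfl | rfl | rfl | rfl
        · exact ha
        · exact apply_mem_support.2 ha
        · exact hc
        · exact apply_mem_support.2 hc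
      have hp' : swap a (p a) * swap c (p c) = p := by
        obtain ⟨h1, h2, h3, h4, h5, h6⟩ := hD
        ext z : 1
        rw [Perm.mul_apply]
        by_cases hz : z ∈ p.support
        · rw [← hS] at hz
          simp only [Finset.mem_insert, Finset.mem_singleton] at hz
          rcases hz with rfl | rfl | rfl | rfl
          · rw [swap_apply_of_ne_of_ne h2 h3, swap_apply_left]
          · rw [swap_apply_of_ne_of_ne h4 h5, swap_apply_right, hpp]
          · rw [swap_apply_left, swap_apply_of_ne_of_ne h3.symm h5.symm]
          · rw [swap_apply_right, swap_apply_of_ne_of_ne h2.symm h4.symm, hpp]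
        · have hz' := notMem_support.1 hz
          rw [← hS] at hz
          simp only [Finset.mem_insert, Finset.mem_singleton, not_or] at hz
          rw [swap_apply_of_ne_of_ne hz.2.2.1 hz.2.2.2, swap_apply_of_ne_of_ne hz.1 hz.2.1, hz']
      simp only [Finset.coe_filter, Set.mem_ofPred_eq, Finset.mem_filter, Finset.mem_univ,
        true_and]
      exact ⟨⟨hD, hp'.symm ▸ hGp⟩, hp'⟩
    · rintro ⟨a, b, c, d⟩ ht
      simp only [Finset.coe_filter, Set.mem_ofPred_eq, Finset.mem_filter, Finset.mem_univ,
        true_and] at ht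
      obtain ⟨⟨⟨h1, h2, h3, h4, h5, h6⟩, -⟩, rfl⟩ := ht
      simp only [Perm.mul_apply, swap_apply_of_ne_of_ne h2 h3, swap_apply_left,
        swap_apply_of_ne_of_ne h3.symm h5.symm]
    · rintro ⟨a, c⟩ _
      rfl
  · rintro ⟨a, b, c, d⟩ ht
    simp only [Finset.coe_filter, Set.mem_ofPred_eq, Finset.mem_univ, true_and] at ht ⊢
    refine ⟨?_, ht.2⟩
    rw [support_swap_mul_swap ht.1, card_quad ht.1]

theorem eight_mul_numPerturb (Q : Finset (Fin n) → Prop) :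
    8 * numPerturb f 4 Q =
      quad fun a b c d => Distinct a b c d ∧ Good f a b c d ∧ Q {a, b, c, d} := by
  classical
  have key := quad_swap_mul_swap fun p => lens (f * p) = lens f ∧ Q p.support
  rw [numPerturb]
  convert (key ?_).symm using 1
  · congr!
  · refine quad_congr fun a b c d => and_congr_right fun h => ?_
    rw [support_swap_mul_swap h, Good, mul_assoc]
  -- Conjugate permutations have equal sign, so `sign (f * p) = sign f` forces `p` to be even.
  · rintro p ⟨h, -⟩
    obtain ⟨c, hc⟩ := isConj_iff.1 (isConj_iff_lens_eq.2 h)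
    have h1 := congrArg sign hc
    simp only [map_mul, map_inv] at h1
    have h2 : sign c * (sign f * sign p) * (sign c)⁻¹ = sign f * sign p := by
      rw [mul_comm (sign c), mul_inv_cancel_right]
    rw [h2] at h1
    simpa using h1

end Quad

/-! ### Normal forms of good quadruples for each type -/

section Patterns

variable {n : ℕ} {f : Perm (Fin n)}

/-- The alternatives separate the placements that can be good, up to symmetry of the quadruple, from
those excluded by counting cycles: the last one for `{2, 2}` (two cuts) and the last one for `{2, 1,
1}` (two joins). After translation into pairwise relations, transitivity leaves a finite
propositional check. -/
theorem typ_quad_iff {a b c d : Fin n} (h : Distinct a b c d) :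
    (typ f {a, b, c, d} = {4} ↔ f.SameCycle a b ∧ f.SameCycle a c ∧ f.SameCycle a d) ∧
    (typ f {a, b, c, d} = {3, 1} ↔
      (¬f.SameCycle a b ∧ f.SameCycle b c ∧ f.SameCycle b d) ∨
      (¬f.SameCycle a b ∧ f.SameCycle a c ∧ f.SameCycle a d) ∨
      (¬f.SameCycle c d ∧ f.SameCycle a d ∧ f.SameCycle b d) ∨
      (¬f.SameCycle c d ∧ f.SameCycle a c ∧ f.SameCycle b c)) ∧
    (typ f {a, b, c, d} = {2, 2} ↔
      (¬f.SameCycle a b ∧ f.SameCycle a c ∧ f.SameCycle b d) ∨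
      (¬f.SameCycle a b ∧ f.SameCycle a d ∧ f.SameCycle b c) ∨
      (¬f.SameCycle a c ∧ f.SameCycle a b ∧ f.SameCycle c d)) ∧
    (typ f {a, b, c, d} = {2, 1, 1} ↔
      (¬f.SameCycle a b ∧ ¬f.SameCycle a c ∧ ¬f.SameCycle b c ∧ f.SameCycle c d) ∨
      (¬f.SameCycle c d ∧ ¬f.SameCycle a c ∧ ¬f.SameCycle a d ∧ f.SameCycle a b) ∨
      (¬f.SameCycle a b ∧ ¬f.SameCycle c d ∧
        ((¬f.SameCycle a d ∧ ¬f.SameCycle b d) ∨ (¬f.SameCycle a c ∧ ¬f.SameCycle b c)) ∧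
        (f.SameCycle a c ∨ f.SameCycle b c ∨ f.SameCycle a d ∨ f.SameCycle b d))) ∧
    (typ f {a, b, c, d} = {1, 1, 1, 1} ↔
      ¬f.SameCycle a b ∧ ¬f.SameCycle a c ∧ ¬f.SameCycle a d ∧ ¬f.SameCycle b c ∧
        ¬f.SameCycle b d ∧ ¬f.SameCycle c d) := by
  have key := typ_eq_iff (f := f) (card_quad h)
  rw [sum_sameCycle_quad h] at key
  obtain ⟨k4, k31, k22, k211, k1111⟩ := key
  rw [k4, k31, k22, k211, k1111]
  have t1 : f.SameCycle a b → (f.SameCycle a c ↔ f.SameCycle b c) := fun h =>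
    ⟨fun h' => h.symm.trans h', fun h' => h.trans h'⟩
  have t2 : f.SameCycle a b → (f.SameCycle a d ↔ f.SameCycle b d) := fun h =>
    ⟨fun h' => h.symm.trans h', fun h' => h.trans h'⟩
  have t3 : f.SameCycle c d → (f.SameCycle a c ↔ f.SameCycle a d) := fun h =>
    ⟨fun h' => h'.trans h, fun h' => h'.trans h.symm⟩
  have t4 : f.SameCycle c d → (f.SameCycle b c ↔ f.SameCycle b d) := fun h =>
    ⟨fun h' => h'.trans h, fun h' => h'.trans h.symm⟩
  have t5 : f.SameCycle a c → f.SameCycle b c → f.SameCycle a b := fun h h' => h.trans h'.symm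
  have t6 : f.SameCycle a d → f.SameCycle b d → f.SameCycle a b := fun h h' => h.trans h'.symm
  have t7 : f.SameCycle a c → f.SameCycle a d → f.SameCycle c d := fun h h' => h.symm.trans h'
  have t8 : f.SameCycle b c → f.SameCycle b d → f.SameCycle c d := fun h h' => h.symm.trans h'
  clear k4 k31 k22 k211 k1111 h
  by_cases h1 : f.SameCycle a b <;> by_cases h2 : f.SameCycle a c <;>
    by_cases h3 : f.SameCycle a d <;> by_cases h4 : f.SameCycle b c <;>
    by_cases h5 : f.SameCycle b d <;> by_cases h6 : f.SameCycle c d <;> simp_all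

/-- Four distinct points of one cycle of `f`, in a good configuration. -/
def Pattern4 (f : Perm (Fin n)) (a b c d : Fin n) : Prop :=
  f.SameCycle a b ∧ f.SameCycle a c ∧ f.SameCycle a d ∧ Distinct a b c d ∧ Good f a b c d

/-- A good configuration in which `b`, `c`, `d` are distinct points of one cycle of `f` that does
not contain `a`. -/
def Pattern31 (f : Perm (Fin n)) (a b c d : Fin n) : Prop :=
  ¬f.SameCycle a b ∧ f.SameCycle b c ∧ f.SameCycle b d ∧ b ≠ c ∧ b ≠ d ∧ c ≠ d ∧ Good f a b c d

/-- A good configuration in which `a ≠ c` lie in one cycle of `f` and `b ≠ d` in another. -/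
def Pattern22 (f : Perm (Fin n)) (a b c d : Fin n) : Prop :=
  ¬f.SameCycle a b ∧ f.SameCycle a c ∧ f.SameCycle b d ∧ a ≠ c ∧ b ≠ d ∧ Good f a b c d

/-- A good configuration in which `a`, `b`, `c` lie in three different cycles of `f`, and `d ≠ c`
lies in that of `c`. -/
def Pattern211 (f : Perm (Fin n)) (a b c d : Fin n) : Prop :=
  ¬f.SameCycle a b ∧ ¬f.SameCycle a c ∧ ¬f.SameCycle b c ∧ f.SameCycle c d ∧ c ≠ d ∧
    Good f a b c d

theorem ne_of_not_sameCycle {x y : Fin n} (h : ¬f.SameCycle x y) : x ≠ y :=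
  fun h' => h (h' ▸ SameCycle.refl _ _)

theorem Pattern31.distinct {a b c d : Fin n} (h : Pattern31 f a b c d) : Distinct a b c d :=
  ⟨ne_of_not_sameCycle h.1, ne_of_not_sameCycle fun h' => h.1 (h'.trans h.2.1.symm),
    ne_of_not_sameCycle fun h' => h.1 (h'.trans h.2.2.1.symm), h.2.2.2.1, h.2.2.2.2.1,
    h.2.2.2.2.2.1⟩

theorem Pattern22.distinct {a b c d : Fin n} (h : Pattern22 f a b c d) : Distinct a b c d :=
  ⟨ne_of_not_sameCycle h.1, h.2.2.2.1,
    ne_of_not_sameCycle fun h' => h.1 (h'.trans h.2.2.1.symm),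
    ne_of_not_sameCycle fun h' => h.1 (h.2.1.trans h'.symm), h.2.2.2.2.1,
    ne_of_not_sameCycle fun h' => h.1 ((h.2.1.trans h').trans h.2.2.1.symm)⟩

theorem Pattern211.distinct {a b c d : Fin n} (h : Pattern211 f a b c d) : Distinct a b c d :=
  ⟨ne_of_not_sameCycle h.1, ne_of_not_sameCycle h.2.1,
    ne_of_not_sameCycle fun h' => h.2.1 (h'.trans h.2.2.2.1.symm), ne_of_not_sameCycle h.2.2.1,
    ne_of_not_sameCycle fun h' => h.2.2.1 (h'.trans h.2.2.2.1.symm), h.2.2.2.2.1⟩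

theorem Distinct.swap_left {a b c d : Fin n} (h : Distinct a b c d) : Distinct b a c d :=
  ⟨h.1.symm, h.2.2.2.1, h.2.2.2.2.1, h.2.1, h.2.2.1, h.2.2.2.2.2⟩

theorem Distinct.swap_right {a b c d : Fin n} (h : Distinct a b c d) : Distinct a b d c :=
  ⟨h.1, h.2.2.1, h.2.1, h.2.2.2.2.1, h.2.2.2.1, h.2.2.2.2.2.symm⟩

theorem Distinct.swap_pairs {a b c d : Fin n} (h : Distinct a b c d) : Distinct c d a b :=
  ⟨h.2.2.2.2.2, h.2.1.symm, h.2.2.2.1.symm, h.2.2.1.symm, h.2.2.2.2.1.symm, h.1⟩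

theorem Distinct.good_swap_pairs {a b c d : Fin n} (h : Distinct a b c d) :
    Good f c d a b ↔ Good f a b c d :=
  KCommute.good_swap_pairs h.2.1 h.2.2.1 h.2.2.2.1 h.2.2.2.2.1

theorem pattern31_iff {a b c d : Fin n} (h : Distinct a b c d) : Pattern31 f a b c d ↔
    ¬f.SameCycle a b ∧ f.SameCycle b c ∧ f.SameCycle b d ∧ Good f a b c d := by
  simp [Pattern31, h.2.2.2.1, h.2.2.2.2.1, h.2.2.2.2.2]

theorem pattern22_iff {a b c d : Fin n} (h : Distinct a b c d) : Pattern22 f a b c d ↔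
    ¬f.SameCycle a b ∧ f.SameCycle a c ∧ f.SameCycle b d ∧ Good f a b c d := by
  simp [Pattern22, h.2.1, h.2.2.2.2.1]

theorem pattern211_iff {a b c d : Fin n} (h : Distinct a b c d) : Pattern211 f a b c d ↔
    ¬f.SameCycle a b ∧ ¬f.SameCycle a c ∧ ¬f.SameCycle b c ∧ f.SameCycle c d ∧
      Good f a b c d := by
  simp [Pattern211, h.2.2.2.2.2]

theorem eight_mul_numPerturb_four :
    8 * numPerturb f 4 (fun S => typ f S = {4}) = quad (Pattern4 f) := by
  rw [eight_mul_numPerturb]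
  refine quad_congr fun a b c d => ?_
  rw [Pattern4]
  constructor
  · rintro ⟨hD, hG, ht⟩
    rw [(typ_quad_iff hD).1] at ht
    tauto
  · rintro ⟨h1, h2, h3, hD, hG⟩
    exact ⟨hD, hG, (typ_quad_iff hD).1.2 ⟨h1, h2, h3⟩⟩

/-- The factor 4 is the choice of which of the four points lies alone in its cycle. -/
theorem eight_mul_numPerturb_three_one :
    8 * numPerturb f 4 (fun S => typ f S = {3, 1}) = 4 * quad (Pattern31 f) := by
  have key : 8 * numPerturb f 4 (fun S => typ f S = {3, 1}) = quad fun a b c d =>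
      Pattern31 f a b c d ∨ Pattern31 f b a c d ∨ Pattern31 f c d a b ∨ Pattern31 f d c a b := by
    rw [eight_mul_numPerturb]
    refine quad_congr fun a b c d => ?_
    by_cases hD : Distinct a b c d
    · rw [(typ_quad_iff hD).2.1, pattern31_iff hD, pattern31_iff hD.swap_left,
        pattern31_iff hD.swap_pairs, pattern31_iff hD.swap_pairs.swap_left,
        good_swap_left (a := a) (b := b), good_swap_left (a := c) (b := d), hD.good_swap_pairs,
        sameCycle_comm (x := b) (y := a), sameCycle_comm (x := d) (y := c),
        sameCycle_comm (x := d) (y := a), sameCycle_comm (x := d) (y := b),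
        sameCycle_comm (x := c) (y := a), sameCycle_comm (x := c) (y := b)]
      tauto
    · refine iff_of_false (fun h => hD h.1) ?_
      rintro (h | h | h | h)
      · exact hD h.distinct
      · exact hD h.distinct.swap_left
      · exact hD h.distinct.swap_pairs
      · exact hD h.distinct.swap_left.swap_pairs
  rw [key, quad_or, quad_or, quad_or, quad_swap_left (Pattern31 f), quad_swap_pairs (Pattern31 f),
    quad_swap_pairs fun a b c d => Pattern31 f b a c d, quad_swap_left (Pattern31 f)]
  · ring
  · rintro a b c d ⟨h1, h2, h3, -⟩ ⟨h4, h5, -⟩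
    exact h4 (h2.trans h5.symm)
  · rintro a b c d ⟨h1, h2, h3, -⟩ (⟨h4, h5, h6, -⟩ | ⟨h4, h5, h6, -⟩)
    · exact h1 (h6.symm.trans h5)
    · exact h1 (h6.symm.trans h5)
  · rintro a b c d ⟨h1, h2, h3, -⟩ (⟨h4, h5, h6, -⟩ | ⟨h4, h5, h6, -⟩ | ⟨h4, h5, h6, -⟩)
    · exact h1 (h5.trans h2.symm)
    · exact h1 (h5.symm.trans h6)
    · exact h1 (h5.symm.trans h6)

/-- The factor 2 is the choice of which of `c`, `d` shares the cycle of `a`; the placement in which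
both transpositions cut is not good. -/
theorem eight_mul_numPerturb_two_two :
    8 * numPerturb f 4 (fun S => typ f S = {2, 2}) = 2 * quad (Pattern22 f) := by
  have key : 8 * numPerturb f 4 (fun S => typ f S = {2, 2}) = quad fun a b c d =>
      Pattern22 f a b c d ∨ Pattern22 f a b d c := by
    rw [eight_mul_numPerturb]
    refine quad_congr fun a b c d => ?_
    by_cases hD : Distinct a b c d
    · rw [(typ_quad_iff hD).2.2.1, pattern22_iff hD, pattern22_iff hD.swap_right,
        good_swap_right (c := c) (d := d)]
      have := fun h1 h2 h3 => not_good_of_split_split (f := f) h1 h2 h3 hD.1 hD.2.2.2.2.2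
      tauto
    · refine iff_of_false (fun h => hD h.1) ?_
      rintro (h | h)
      · exact hD h.distinct
      · exact hD h.distinct.swap_right
  rw [key, quad_or, quad_swap_right (Pattern22 f)]
  · ring
  · rintro a b c d ⟨h1, h2, h3, -⟩ ⟨h4, h5, h6, -⟩
    exact h1 (h5.trans h3.symm)

/-- The factor 2 is the choice of which transposition joins and which cuts; placements in which
neither lies inside a cycle give two joins. -/
theorem eight_mul_numPerturb_two_one_one :
    8 * numPerturb f 4 (fun S => typ f S = {2, 1, 1}) = 2 * quad (Pattern211 f) := by
  have key : 8 * numPerturb f 4 (fun S => typ f S = {2, 1, 1}) = quad fun a b c d =>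
      Pattern211 f a b c d ∨ Pattern211 f c d a b := by
    rw [eight_mul_numPerturb]
    refine quad_congr fun a b c d => ?_
    by_cases hD : Distinct a b c d
    · rw [(typ_quad_iff hD).2.2.2.1, pattern211_iff hD, pattern211_iff hD.swap_pairs,
        hD.good_swap_pairs, sameCycle_comm (x := c) (y := a), sameCycle_comm (x := d) (y := a)]
      have h1 : ¬f.SameCycle a b → ¬f.SameCycle c d → ¬f.SameCycle a d → ¬f.SameCycle b d →
          ¬Good f a b c d := fun h1 h2 h3 h4 => not_good_of_isolated h1 h3 h4 h2
      have h2 : ¬f.SameCycle a b → ¬f.SameCycle c d → ¬f.SameCycle a c → ¬f.SameCycle b c →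
          ¬Good f a b c d := fun h1 h2 h3 h4 h5 =>
        not_good_of_isolated h1 h3 h4 (fun h => h2 h.symm) (good_swap_right.2 h5)
      tauto
    · refine iff_of_false (fun h => hD h.1) ?_
      rintro (h | h)
      · exact hD h.distinct
      · exact hD h.distinct.swap_pairs
  rw [key, quad_or, quad_swap_pairs (Pattern211 f)]
  · ring
  · rintro a b c d ⟨h1, -⟩ ⟨-, -, -, h2, -⟩
    exact h1 h2

theorem numPerturb_one_one_one_one :
    numPerturb f 4 (fun S => typ f S = {1, 1, 1, 1}) = 0 := by
  have key : 8 * numPerturb f 4 (fun S => typ f S = {1, 1, 1, 1}) = 0 := by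
    rw [eight_mul_numPerturb, quad]
    refine Finset.sum_eq_zero fun a _ => Finset.sum_eq_zero fun b _ =>
      Finset.sum_eq_zero fun c _ => Finset.sum_eq_zero fun d _ => if_neg ?_
    rintro ⟨hD, hG, ht⟩
    rw [(typ_quad_iff hD).2.2.2.2] at ht
    exact not_good_of_isolated ht.1 ht.2.2.1 ht.2.2.2.2.1 ht.2.2.2.2.2 hG
  omega

theorem numPerturb_four_eq_add : numPerturb f 4 (fun _ => True) =
    numPerturb f 4 (fun S => typ f S = {4}) + numPerturb f 4 (fun S => typ f S = {3, 1}) +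
      numPerturb f 4 (fun S => typ f S = {2, 2}) +
      numPerturb f 4 (fun S => typ f S = {2, 1, 1}) := by
  have hor : ∀ P Q : Finset (Fin n) → Prop, (∀ S, P S → ¬Q S) →
      numPerturb f 4 (fun S => P S ∨ Q S) = numPerturb f 4 P + numPerturb f 4 Q := by
    intro P Q h
    have h1 := eight_mul_numPerturb (f := f) fun S => P S ∨ Q S
    simp only [and_or_left] at h1
    rw [quad_or fun a b c d h2 h3 => h _ h2.2.2 h3.2.2, ← eight_mul_numPerturb,
      ← eight_mul_numPerturb] at h1
    omega
  have h1 : numPerturb f 4 (fun _ => True) = numPerturb f 4 (fun S => typ f S = {4} ∨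
      typ f S = {3, 1} ∨ typ f S = {2, 2} ∨ typ f S = {2, 1, 1} ∨ typ f S = {1, 1, 1, 1}) := by
    rw [numPerturb, numPerturb]
    refine card_filter_congr fun p => ?_
    refine ⟨fun h => ⟨h.1, h.2.1, typ_cases h.1⟩, fun h => ⟨h.1, h.2.1, trivial⟩⟩
  rw [h1, hor, hor, hor, hor, numPerturb_one_one_one_one]
  · ring
  all_goals
    intro S h
    rw [h]
    decide

end Patterns

/-! ### Counting the patterns -/

section Counting

variable {n : ℕ} {f : Perm (Fin n)}

theorem card_filter_len (i : ℕ) :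
    (Finset.univ.filter fun x => len f x = i).card = i * cycleCount f i := by
  rw [cycleCount, Finset.card_eq_sum_card_fiberwise (f := cyc f)
    (t := (cycles f).filter fun s => s.card = i), Finset.sum_const_nat (m := i), mul_comm]
  · intro s hs
    obtain ⟨h1, rfl⟩ := Finset.mem_filter.1 hs
    congr 1
    ext x
    simp only [Finset.mem_filter, Finset.mem_univ, true_and]
    constructor
    · rintro ⟨-, rfl⟩
      exact self_mem_cyc
    · intro hx
      have := eq_cyc_of_mem h1 hx
      exact ⟨by rw [← card_cyc, ← this], this.symm⟩
  · intro x hx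
    simp only [Finset.coe_filter, Finset.mem_univ, true_and, Set.mem_ofPred_eq] at hx ⊢
    exact ⟨cyc_mem_cycles, by rw [card_cyc, hx]⟩

theorem sum_len (g : ℕ → ℕ) :
    ∑ x, g (len f x) = ∑ i ∈ Finset.Icc 1 n, i * cycleCount f i * g i := by
  rw [← Finset.sum_fiberwise_of_maps_to (s := Finset.univ) (t := Finset.Icc 1 n) (g := len f)
    fun x _ => Finset.mem_Icc.2 ⟨len_pos, len_le⟩]
  refine Finset.sum_congr rfl fun i _ => ?_
  rw [← card_filter_len, ← smul_eq_mul, ← Finset.sum_const]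
  exact Finset.sum_congr rfl fun x hx => by rw [(Finset.mem_filter.1 hx).2]

theorem sum_univ_eq_sum_range_len {x : Fin n} (g : Fin n → ℕ)
    (hg : ∀ y, ¬f.SameCycle x y → g y = 0) :
    ∑ y, g y = ∑ p ∈ Finset.range (len f x), g ((f ^ p) x) := by
  rw [← sum_cyc]
  refine (Finset.sum_subset (Finset.subset_univ _) fun y _ hy => hg y ?_).symm
  rwa [mem_cyc] at hy

theorem card_filter_not_sameCycle_len (a : Fin n) :
    (Finset.univ.filter fun b => ¬f.SameCycle a b ∧ len f a = len f b).card =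
      len f a * (cycleCount f (len f a) - 1) := by
  have h1 : (Finset.univ.filter fun b => ¬f.SameCycle a b ∧ len f a = len f b) =
      (Finset.univ.filter fun b => len f b = len f a) \ cyc f a := by
    ext b
    simp only [Finset.mem_filter, Finset.mem_univ, true_and, Finset.mem_sdiff, mem_cyc]
    rw [eq_comm, and_comm]
  rw [h1, Finset.card_sdiff_of_subset, card_filter_len, card_cyc, Nat.mul_sub, mul_one]
  intro b hb
  rw [Finset.mem_filter]
  exact ⟨Finset.mem_univ _, (len_eq (mem_cyc.1 hb)).symm⟩

/-- Pairs in different cycles are separated by equal or unequal length, and symmetry of `U` doubles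
the unequal case. The truncated `cycleCount f i - 1` is harmless because it is multiplied by
`cycleCount f i`. -/
theorem sum_not_sameCycle (U : ℕ → ℕ → ℕ) (hU : ∀ i j, U i j = U j i) :
    (∑ a, ∑ b, if ¬f.SameCycle a b then U (len f a) (len f b) else 0) =
      (∑ i ∈ Finset.Icc 1 n, i * cycleCount f i * (i * (cycleCount f i - 1) * U i i)) +
        2 * ∑ i ∈ Finset.Icc 1 n, ∑ j ∈ Finset.Icc (i + 1) n,
          i * cycleCount f i * (j * cycleCount f j * U i j) := by
  have h1 : ∀ a b, (if ¬f.SameCycle a b then U (len f a) (len f b) else 0) =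
      (if ¬f.SameCycle a b ∧ len f a = len f b then U (len f a) (len f a) else 0) +
        (if len f a < len f b then U (len f a) (len f b) else 0) +
        (if len f b < len f a then U (len f b) (len f a) else 0) := by
    intro a b
    by_cases h : f.SameCycle a b
    · simp [h, len_eq h]
    · rcases lt_trichotomy (len f a) (len f b) with h2 | h2 | h2
      · simp [h, h2, h2.ne, h2.not_gt]
      · simp [h, h2]
      · simp [h, h2, h2.ne', h2.not_gt, hU (len f a)]
  have h2 : (∑ a, ∑ b, if len f a < len f b then U (len f a) (len f b) else 0) =
      ∑ i ∈ Finset.Icc 1 n, ∑ j ∈ Finset.Icc (i + 1) n,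
          i * cycleCount f i * (j * cycleCount f j * U i j) := by
    rw [Finset.sum_congr rfl fun a _ =>
        sum_len (f := f) fun j => if len f a < j then U (len f a) j else 0,
      sum_len (f := f) fun i => ∑ j ∈ Finset.Icc 1 n, j * cycleCount f j *
      if i < j then U i j else 0]
    refine Finset.sum_congr rfl fun i hi => ?_
    rw [Finset.mul_sum]
    refine (Finset.sum_subset_zero_on_sdiff
      (Finset.Icc_subset_Icc_left (by omega)) ?_ ?_).symm
    · intro j hj
      simp only [Finset.mem_sdiff, Finset.mem_Icc] at hj hi
      rw [if_neg (by omega), mul_zero, mul_zero]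
    · intro j hj
      rw [if_pos (Nat.lt_of_succ_le (Finset.mem_Icc.1 hj).1)]
  have h3 : (∑ a, ∑ b, if len f b < len f a then U (len f b) (len f a) else 0) =
      ∑ a, ∑ b, if len f a < len f b then U (len f a) (len f b) else 0 := Finset.sum_comm
  have h4 : (∑ a, ∑ b, if ¬f.SameCycle a b ∧ len f a = len f b then
      U (len f a) (len f a) else 0) =
      ∑ i ∈ Finset.Icc 1 n, i * cycleCount f i * (i * (cycleCount f i - 1) * U i i) := by
    rw [← sum_len (f := f) fun i => i * (cycleCount f i - 1) * U i i]
    refine Finset.sum_congr rfl fun a _ => ?_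
    rw [← Finset.sum_filter, Finset.sum_const, card_filter_not_sameCycle_len, smul_eq_mul]
  simp only [h1, Finset.sum_add_distrib]
  rw [h3, h2, h4]
  ring

theorem two_mul_choose_two (m : ℕ) : 2 * m.choose 2 = m * (m - 1) := by
  cases m with
  | zero => rfl
  | succ m =>
    have := Nat.add_one_mul_choose_eq m 1
    simp only [Nat.choose_one_right] at this
    rw [Nat.add_sub_cancel, this, mul_comm]

theorem sum_range_pred (m : ℕ) : ∑ k ∈ Finset.range (m + 1), (k - 1) = m.choose 2 := by
  induction m with
  | zero => rfl
  | succ m ih =>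
    rw [Finset.sum_range_succ, ih, Nat.choose_succ_succ, Nat.choose_one_right,
      Nat.add_sub_cancel, add_comm]

/-- Triples are counted by their middle element. The term `k = 0` vanishes by truncated subtraction.
-/
theorem sum_range_pred_mul_sub (m : ℕ) :
    ∑ k ∈ Finset.range (m + 1), (k - 1) * (m - k) = m.choose 3 := by
  induction m with
  | zero => rfl
  | succ m ih =>
    rw [Finset.sum_range_succ, Nat.sub_self, mul_zero, add_zero, Nat.choose_succ_succ, ← ih,
      ← sum_range_pred, ← Finset.sum_add_distrib]
    refine Finset.sum_congr rfl fun k hk => ?_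
    rw [Nat.sub_add_comm (Nat.lt_succ_iff.1 (Finset.mem_range.1 hk))]
    ring

theorem quad_pattern4 : quad (Pattern4 f) =
    8 * ∑ i ∈ Finset.Icc 4 n, cycleCount f i * i.choose 4 := by
  classical
  -- For fixed `a, b`, the points `c, d` are taken from opposite halves of the cut cycle, with `a`
  -- and `b` removed, in one of two orders.
  have h1 : ∀ a b, a ≠ b → f.SameCycle a b → (∑ c, ∑ d, if Pattern4 f a b c d then 1 else 0) =
      2 * ((len (f * swap a b) b - 1) * (len (f * swap a b) a - 1)) := by
    intro a b hne hab
    set A := (cyc (f * swap a b) a).erase a with hA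
    set B := (cyc (f * swap a b) b).erase b with hB
    have hN := not_sameCycle_mul_swap hab hne
    have hU : ∀ u, f.SameCycle a u ↔
        (f * swap a b).SameCycle a u ∨ (f * swap a b).SameCycle b u := by
      intro u
      obtain ⟨k, hk0, hk, hb⟩ := exists_pow_of_sameCycle_of_ne hab hne
      rw [← mem_cyc, cyc_mul_swap_split hk0 hk hb, Finset.mem_union, mem_cyc, mem_cyc]
    have hP : ∀ c d, Pattern4 f a b c d ↔ (c ∈ A ∧ d ∈ B) ∨ (c ∈ B ∧ d ∈ A) := by
      intro c d
      simp only [hA, hB, Finset.mem_erase, mem_cyc]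
      constructor
      · rintro ⟨-, hac, had, ⟨-, h2, h3, h4, h5, h6⟩, hG⟩
        rw [good_iff_of_sameCycle hab hac had hne h6, mem_cyc, mem_cyc, mem_cyc, mem_cyc] at hG
        rcases hG with hG | hG
        · exact Or.inl ⟨⟨h2.symm, hG.1⟩, h5.symm, hG.2⟩
        · exact Or.inr ⟨⟨h4.symm, hG.1⟩, h3.symm, hG.2⟩
      · have hsep : ∀ {u v}, (f * swap a b).SameCycle a u → (f * swap a b).SameCycle b v →
            u ≠ v := by
          rintro u v hu hv rfl
          exact hN (hu.trans hv.symm)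
        rintro (⟨⟨h1, hc⟩, h2, hd⟩ | ⟨⟨h1, hc⟩, h2, hd⟩)
        · have hac := (hU c).2 (Or.inl hc)
          have had := (hU d).2 (Or.inr hd)
          refine ⟨hab, hac, had, ⟨hne, h1.symm, hsep (SameCycle.refl _ _) hd,
            (hsep hc (SameCycle.refl _ _)).symm, h2.symm, hsep hc hd⟩, ?_⟩
          rw [good_iff_of_sameCycle hab hac had hne (hsep hc hd), mem_cyc, mem_cyc]
          exact Or.inl ⟨hc, hd⟩
        · have hac := (hU c).2 (Or.inr hc)
          have had := (hU d).2 (Or.inl hd)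
          refine ⟨hab, hac, had, ⟨hne, hsep (SameCycle.refl _ _) hc, h2.symm, h1.symm,
            (hsep hd (SameCycle.refl _ _)).symm, (hsep hd hc).symm⟩, ?_⟩
          rw [good_iff_of_sameCycle hab hac had hne (hsep hd hc).symm, mem_cyc, mem_cyc, mem_cyc,
            mem_cyc]
          exact Or.inr ⟨hc, hd⟩
    have hdisj : Disjoint A B := by
      rw [Finset.disjoint_left]
      intro u hu hv
      exact hN ((mem_cyc.1 (Finset.mem_of_mem_erase hu)).trans
        (mem_cyc.1 (Finset.mem_of_mem_erase hv)).symm)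
    have h2 : ∀ c d, (if Pattern4 f a b c d then 1 else 0) =
        (if c ∈ A then 1 else 0) * (if d ∈ B then 1 else 0) +
          (if c ∈ B then 1 else 0) * (if d ∈ A then 1 else 0) := by
      intro c d
      have h3 : c ∈ A → c ∉ B := fun h => Finset.disjoint_left.1 hdisj h
      rw [if_congr (hP c d) rfl rfl]
      by_cases hcA : c ∈ A
      · simp [hcA, h3 hcA]
      · simp only [hcA, false_and, false_or, if_false, zero_mul, zero_add]
        by_cases hcB : c ∈ B <;> simp [hcB]
    simp only [h2, Finset.sum_add_distrib, ← Finset.mul_sum, ← Finset.sum_mul,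
      Finset.sum_ite_mem, Finset.univ_inter, Finset.sum_const, smul_eq_mul, mul_one]
    rw [hA, hB, Finset.card_erase_of_mem self_mem_cyc, Finset.card_erase_of_mem self_mem_cyc,
      card_cyc, card_cyc]
    ring
  have h2 : ∀ a, (∑ b, ∑ c, ∑ d, if Pattern4 f a b c d then 1 else 0) =
      2 * (len f a - 1).choose 3 := by
    intro a
    obtain ⟨m, hm⟩ := Nat.exists_eq_add_of_lt (len_pos (f := f) (x := a))
    rw [zero_add] at hm
    rw [sum_univ_eq_sum_range_len (f := f) (x := a), hm, Nat.add_sub_cancel,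
      ← sum_range_pred_mul_sub, Finset.mul_sum]
    · refine Finset.sum_congr rfl fun k hk => ?_
      rw [Finset.mem_range, ← hm] at hk
      rcases Nat.eq_zero_or_pos k with rfl | hk0
      · rw [zero_tsub, zero_mul, mul_zero]
        refine Finset.sum_eq_zero fun c _ => Finset.sum_eq_zero fun d _ => if_neg ?_
        rintro ⟨-, -, -, h, -⟩
        exact h.1 rfl
      · rw [h1 _ _ (pow_ne_self hk0 hk).symm (sameCycle_pow k),
          len_mul_swap_split_right hk0 hk rfl, len_mul_swap_split_left hk0 hk rfl, hm]
        congr 2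
        omega
    · intro b hb
      exact Finset.sum_eq_zero fun c _ => Finset.sum_eq_zero fun d _ => if_neg fun h => hb h.1
  rw [quad, Finset.sum_congr rfl fun a _ => h2 a, sum_len (f := f) fun i => 2 * (i - 1).choose 3,
    Finset.mul_sum]
  -- Absorption gives `i * (i - 1).choose 3 = 4 * i.choose 4`.
  have h3 : ∀ i ∈ Finset.Icc 1 n, i * cycleCount f i * (2 * (i - 1).choose 3) =
      8 * (cycleCount f i * i.choose 4) := by
    intro i hi
    obtain ⟨m, rfl⟩ := Nat.exists_eq_add_of_le' (Finset.mem_Icc.1 hi).1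
    have := Nat.add_one_mul_choose_eq m 3
    simp only [Nat.reduceAdd] at this
    rw [Nat.add_sub_cancel]
    calc _ = 2 * cycleCount f (m + 1) * ((m + 1) * m.choose 3) := by ring
      _ = _ := by rw [this]; ring
  rw [Finset.sum_congr rfl h3]
  refine (Finset.sum_subset (Finset.Icc_subset_Icc_left (by norm_num)) fun i hi hi' => ?_).symm
  simp only [Finset.mem_Icc] at hi hi'
  rw [Nat.choose_eq_zero_of_lt (by omega)]
  simp

/-- These are the ordered pairs of nonzero positions at distance exactly `i`; position 0 is reserved
for the point `b`. -/
theorem sum_range_sum_range_add {l i : ℕ} (hi : 0 < i) :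
    (∑ p ∈ Finset.range l, ∑ q ∈ Finset.range l,
      if 0 < p ∧ 0 < q ∧ (q = p + i ∨ p = q + i) then 1 else 0) = 2 * (l - i - 1) := by
  have h1 : (∑ p ∈ Finset.range l, ∑ q ∈ Finset.range l,
      if 0 < p ∧ q = p + i then 1 else 0) = l - i - 1 := by
    have h2 : ∀ p ∈ Finset.range l, (∑ q ∈ Finset.range l, if 0 < p ∧ q = p + i then 1 else 0) =
        if p ∈ Finset.Ico 1 (l - i) then 1 else 0 := by
      intro p _
      simp only [ite_and, Finset.mem_Ico]
      by_cases hp : 0 < p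
      · simp only [hp, if_true, Finset.sum_ite_eq', Finset.mem_range]
        split_ifs <;> omega
      · rw [if_neg (by omega)]
        simp [hp]
    rw [Finset.sum_congr rfl h2, Finset.sum_ite_mem, Finset.inter_eq_right.2, Finset.sum_const,
      Nat.card_Ico, smul_eq_mul, mul_one]
    intro p hp
    rw [Finset.mem_Ico] at hp
    rw [Finset.mem_range]
    omega
  have h3 : ∀ p q : ℕ, (if 0 < p ∧ 0 < q ∧ (q = p + i ∨ p = q + i) then 1 else 0) =
      (if 0 < p ∧ q = p + i then 1 else 0) + if 0 < q ∧ p = q + i then 1 else 0 := by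
    intro p q
    by_cases h4 : 0 < p ∧ q = p + i
    · rw [if_pos h4, if_pos (by omega), if_neg (by omega)]
    · rw [if_neg h4, zero_add]
      refine if_congr ?_ rfl rfl
      omega
  simp only [h3, Finset.sum_add_distrib]
  rw [Finset.sum_comm (f := fun p q => if 0 < q ∧ p = q + i then 1 else 0), h1]
  ring

theorem pattern31_pow_iff {a b : Fin n} (hab : ¬f.SameCycle a b) {p q : ℕ} (hp : p < len f b)
    (hq : q < len f b) : Pattern31 f a b ((f ^ p) b) ((f ^ q) b) ↔
      0 < p ∧ 0 < q ∧ (q = p + len f a ∨ p = q + len f a) := by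
  have hl := len_pos (f := f) (x := a)
  rcases Nat.eq_zero_or_pos p with rfl | hp0
  · exact iff_of_false (fun h => h.2.2.2.1 rfl) fun h => by omega
  rcases Nat.eq_zero_or_pos q with rfl | hq0
  · exact iff_of_false (fun h => h.2.2.2.2.1 rfl) fun h => by omega
  have h1 : (f ^ p) b ≠ (f ^ q) b ↔ p ≠ q := not_congr (pow_inj hp hq)
  have h2 := (pow_ne_self hp0 hp).symm
  have h3 := (pow_ne_self hq0 hq).symm
  simp only [Pattern31, hab, sameCycle_pow, h1, not_false_eq_true, true_and, h2, h3, hp0, hq0, ne_eq]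
  rcases lt_trichotomy p q with h | h | h
  · rw [good_iff_of_isolated_left hab hp0 h hq rfl rfl]
    omega
  · exact iff_of_false (fun h' => h'.1 h) (by omega)
  · rw [← good_swap_right, good_iff_of_isolated_left hab hq0 h hp rfl rfl]
    omega

theorem quad_pattern31 : quad (Pattern31 f) =
    2 * ∑ i ∈ Finset.Icc 1 n, ∑ j ∈ Finset.Icc (i + 2) n,
      i * j * (j - i - 1) * cycleCount f i * cycleCount f j := by
  classical
  have h1 : ∀ a b, (∑ c, ∑ d, if Pattern31 f a b c d then 1 else 0) =
      2 * (len f b - len f a - 1) := by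
    intro a b
    by_cases hab : f.SameCycle a b
    · rw [len_eq hab, Nat.sub_self, zero_tsub, mul_zero]
      exact Finset.sum_eq_zero fun c _ => Finset.sum_eq_zero fun d _ => if_neg fun h => h.1 hab
    · rw [← sum_range_sum_range_add len_pos, sum_univ_eq_sum_range_len (f := f) (x := b)]
      · refine Finset.sum_congr rfl fun p hp => ?_
        rw [sum_univ_eq_sum_range_len (f := f) (x := b)]
        · refine Finset.sum_congr rfl fun q hq => if_congr ?_ rfl rfl
          exact pattern31_pow_iff hab (Finset.mem_range.1 hp) (Finset.mem_range.1 hq)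
        · intro d hd
          exact if_neg fun h => hd h.2.2.1
      · intro c hc
        exact Finset.sum_eq_zero fun d _ => if_neg fun h => hc h.2.1
  simp only [quad, h1]
  rw [Finset.sum_congr rfl fun a _ => sum_len (f := f) fun j => 2 * (j - len f a - 1), sum_len (f := f) fun i => ∑ j ∈ Finset.Icc 1 n, j * cycleCount f j * (2 * (j - i - 1)),
    Finset.mul_sum]
  refine Finset.sum_congr rfl fun i hi => ?_
  rw [Finset.mul_sum, Finset.mul_sum]
  refine (Finset.sum_subset_zero_on_sdiff (Finset.Icc_subset_Icc_left (by omega)) ?_ ?_).symm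
  · intro j hj
    simp only [Finset.mem_sdiff, Finset.mem_Icc] at hj
    rw [show j - i - 1 = 0 by omega]
    ring
  · intro j _
    ring

/-- Each nonzero position in the shorter cycle has two partners in the longer one, at equal distance
from the start or from the end; they coincide when the lengths agree. -/
theorem sum_range_sum_range_pair {i j : ℕ} :
    (∑ q ∈ Finset.range i, ∑ p ∈ Finset.range j,
      if 0 < q ∧ 0 < p ∧ (p = q ∨ p + i = q + j) then 1 else 0) =
      if i = j then i - 1 else 2 * (min i j - 1) := by
  have key : ∀ i j : ℕ, i ≤ j → (∑ q ∈ Finset.range i, ∑ p ∈ Finset.range j,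
      if 0 < q ∧ 0 < p ∧ (p = q ∨ p + i = q + j) then 1 else 0) =
      if i = j then i - 1 else 2 * (i - 1) := by
    intro i j hij
    have h1 : ∀ q ∈ Finset.range i, (∑ p ∈ Finset.range j,
        if 0 < q ∧ 0 < p ∧ (p = q ∨ p + i = q + j) then 1 else 0) =
        if q ∈ Finset.Ico 1 i then (if i = j then 1 else 2) else 0 := by
      intro q hq
      rw [Finset.mem_range] at hq
      rw [← Finset.card_filter]
      by_cases hq0 : 0 < q
      · rw [if_pos (Finset.mem_Ico.2 ⟨hq0, hq⟩)]
        have h2 : (Finset.range j).filter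
            (fun p => 0 < q ∧ 0 < p ∧ (p = q ∨ p + i = q + j)) = {q, q + j - i} := by
          ext p
          simp only [Finset.mem_filter, Finset.mem_range, Finset.mem_insert,
            Finset.mem_singleton]
          omega
        rw [h2]
        split_ifs with h
        · rw [h, Nat.add_sub_cancel]
          simp
        · exact Finset.card_pair (by omega)
      · rw [if_neg (by simp only [Finset.mem_Ico]; omega), Finset.card_eq_zero,
          Finset.filter_eq_empty_iff]
        intro p _ h
        exact hq0 h.1
    rw [Finset.sum_congr rfl h1, Finset.sum_ite_mem, Finset.inter_eq_right.2, Finset.sum_const,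
      Nat.card_Ico, smul_eq_mul]
    · split_ifs <;> ring
    · intro q hq
      exact Finset.mem_range.2 (Finset.mem_Ico.1 hq).2
  rcases le_total i j with h | h
  · rw [key i j h, min_eq_left h]
  · rw [Finset.sum_comm]
    have h2 := key j i h
    rw [min_eq_right h]
    refine Eq.trans (Finset.sum_congr rfl fun p _ => Finset.sum_congr rfl fun q _ =>
      if_congr ?_ rfl rfl) (h2.trans ?_)
    · omega
    · split_ifs <;> omega

theorem quad_pattern22 : quad (Pattern22 f) =
    4 * ((∑ i ∈ Finset.Icc 2 n, i * i.choose 2 * (cycleCount f i).choose 2) +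
      ∑ i ∈ Finset.Icc 2 n, ∑ j ∈ Finset.Icc (i + 1) n,
        i * (i - 1) * j * cycleCount f i * cycleCount f j) := by
  classical
  have h1 : ∀ a b, (∑ c, ∑ d, if Pattern22 f a b c d then 1 else 0) =
      if ¬f.SameCycle a b then (if len f a = len f b then len f a - 1 else
        2 * (min (len f a) (len f b) - 1)) else 0 := by
    intro a b
    by_cases hab : f.SameCycle a b
    · rw [if_neg (not_not.2 hab)]
      exact Finset.sum_eq_zero fun c _ => Finset.sum_eq_zero fun d _ => if_neg fun h => h.1 hab
    · rw [if_pos hab, ← sum_range_sum_range_pair, sum_univ_eq_sum_range_len (f := f) (x := a)]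
      · refine Finset.sum_congr rfl fun q hq => ?_
        rw [sum_univ_eq_sum_range_len (f := f) (x := b)]
        · refine Finset.sum_congr rfl fun p hp => if_congr ?_ rfl rfl
          rw [Finset.mem_range] at hp hq
          rcases Nat.eq_zero_or_pos q with rfl | hq0
          · exact iff_of_false (fun h => h.2.2.2.1 rfl) fun h => by omega
          rcases Nat.eq_zero_or_pos p with rfl | hp0
          · exact iff_of_false (fun h => h.2.2.2.2.1 rfl) fun h => by omega
          have h2 := (pow_ne_self hp0 hp).symm
          have h3 := (pow_ne_self hq0 hq).symm
          simp only [Pattern22, hab, sameCycle_pow, not_false_eq_true, true_and, h2, h3, hp0, hq0,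
            ne_eq]
          exact good_iff_of_pair_pair hab hq0 hq rfl hp0 hp rfl
        · intro d hd
          exact if_neg fun h => hd h.2.2.1
      · intro c hc
        exact Finset.sum_eq_zero fun d _ => if_neg fun h => hc h.2.1
  have h2 := sum_not_sameCycle (f := f) (fun i j => if i = j then i - 1 else 2 * (min i j - 1))
    fun i j => by
      rw [min_comm]
      split_ifs <;> omega
  refine (Finset.sum_congr rfl fun a _ => Finset.sum_congr rfl fun b _ => h1 a b).trans
    (h2.trans ?_)
  rw [mul_add, Finset.mul_sum, Finset.mul_sum, Finset.mul_sum]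
  congr 1
  · refine (Finset.sum_subset_zero_on_sdiff (Finset.Icc_subset_Icc_left (by omega)) ?_ ?_).symm
    · intro i hi
      simp only [Finset.mem_sdiff, Finset.mem_Icc] at hi
      rw [if_pos rfl, show i - 1 = 0 by omega]
      ring
    · intro i _
      rw [if_pos rfl]
      calc _ = i * (2 * i.choose 2) * (2 * (cycleCount f i).choose 2) := by ring
        _ = _ := by rw [two_mul_choose_two, two_mul_choose_two]; ring
  · refine (Finset.sum_subset_zero_on_sdiff (Finset.Icc_subset_Icc_left (by omega)) ?_ ?_).symm
    · intro i hi
      simp only [Finset.mem_sdiff, Finset.mem_Icc] at hi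
      rw [mul_eq_zero]
      refine Or.inr (Finset.sum_eq_zero fun j hj => ?_)
      have := (Finset.mem_Icc.1 hj).1
      rw [if_neg (by omega), show min i j - 1 = 0 by omega]
      ring
    · intro i _
      rw [Finset.mul_sum, Finset.mul_sum]
      refine Finset.sum_congr rfl fun j hj => ?_
      have := (Finset.mem_Icc.1 hj).1
      rw [if_neg (by omega), min_eq_left (by omega)]
      ring

open scoped Classical in
-- The cut may detach either of the two lengths `len f a`, `len f b`, which gives two positions for
-- `d`, or one if they are equal. Once `len f c` is their sum, `c` automatically lies in a third
-- cycle.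
theorem sum_pattern211 {a b c : Fin n} (hab : ¬f.SameCycle a b) :
    (∑ d, if Pattern211 f a b c d then 1 else 0) =
      if len f c = len f a + len f b then (if len f a = len f b then 1 else 2) else 0 := by
  have hpa := len_pos (f := f) (x := a)
  have hpb := len_pos (f := f) (x := b)
  by_cases hc : len f c = len f a + len f b
  · have hac : ¬f.SameCycle a c := fun h => by
      have := len_eq h
      omega
    have hbc : ¬f.SameCycle b c := fun h => by
      have := len_eq h
      omega
    rw [if_pos hc, sum_univ_eq_sum_range_len (f := f) (x := c)]
    · have h1 : ∀ k ∈ Finset.range (len f c), Pattern211 f a b c ((f ^ k) c) ↔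
          k ∈ ({len f a, len f b} : Finset ℕ) := by
        intro k hk
        rw [Finset.mem_range] at hk
        rw [Finset.mem_insert, Finset.mem_singleton]
        rcases Nat.eq_zero_or_pos k with rfl | hk0
        · exact iff_of_false (fun h => h.2.2.2.2.1 rfl) (by omega)
        have h2 := (pow_ne_self hk0 hk).symm
        simp only [Pattern211, hab, hac, hbc, sameCycle_pow, not_false_eq_true, true_and, h2,
          ne_eq]
        rw [good_iff_of_isolated_isolated hab hac hbc hk0 hk rfl]
        simp [hc]
      rw [Finset.sum_congr rfl fun k hk => if_congr (h1 k hk) rfl rfl, Finset.sum_ite_mem,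
        Finset.inter_eq_right.2, Finset.sum_const, smul_eq_mul, mul_one]
      · split_ifs with h
        · rw [h]
          simp
        · exact Finset.card_pair h
      · intro k hk
        rw [Finset.mem_insert, Finset.mem_singleton] at hk
        rw [Finset.mem_range]
        omega
    · intro d hd
      exact if_neg fun h => hd h.2.2.2.1
  · rw [if_neg hc]
    refine Finset.sum_eq_zero fun d _ => if_neg ?_
    rintro ⟨-, hac, hbc, hcd, hne, hG⟩
    obtain ⟨k, hk0, hk, hd⟩ := exists_pow_of_sameCycle_of_ne hcd hne
    exact hc ((good_iff_of_isolated_isolated hab hac hbc hk0 hk hd).1 hG).1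

theorem quad_pattern211 : quad (Pattern211 f) =
    4 * ((∑ i ∈ Finset.Icc 1 n, i ^ 3 * cycleCount f (2 * i) * (cycleCount f i).choose 2) +
      ∑ i ∈ Finset.Icc 1 n, ∑ j ∈ Finset.Icc (i + 1) n,
        i * j * (i + j) * cycleCount f i * cycleCount f j * cycleCount f (i + j)) := by
  classical
  have h1 : ∀ a b, (∑ c, ∑ d, if Pattern211 f a b c d then 1 else 0) =
      if ¬f.SameCycle a b then (len f a + len f b) * cycleCount f (len f a + len f b) *
        (if len f a = len f b then 1 else 2) else 0 := by
    intro a b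
    by_cases hab : f.SameCycle a b
    · rw [if_neg (not_not.2 hab)]
      exact Finset.sum_eq_zero fun c _ => Finset.sum_eq_zero fun d _ => if_neg fun h => h.1 hab
    · rw [if_pos hab, Finset.sum_congr rfl fun c _ => sum_pattern211 hab, ← Finset.sum_filter,
        Finset.sum_const, card_filter_len, smul_eq_mul]
  have h2 := sum_not_sameCycle (f := f)
    (fun i j => (i + j) * cycleCount f (i + j) * if i = j then 1 else 2)
    fun i j => by simp only [eq_comm (a := i), add_comm i]
  refine (Finset.sum_congr rfl fun a _ => Finset.sum_congr rfl fun b _ => h1 a b).trans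
    (h2.trans ?_)
  rw [mul_add, Finset.mul_sum, Finset.mul_sum, Finset.mul_sum]
  congr 1
  · refine Finset.sum_congr rfl fun i _ => ?_
    rw [if_pos rfl, ← two_mul]
    calc _ = 2 * i ^ 3 * cycleCount f (2 * i) * (cycleCount f i * (cycleCount f i - 1)) := by ring
      _ = _ := by rw [← two_mul_choose_two]; ring
  · refine Finset.sum_congr rfl fun i _ => ?_
    rw [Finset.mul_sum, Finset.mul_sum]
    refine Finset.sum_congr rfl fun j hj => ?_
    have := (Finset.mem_Icc.1 hj).1
    rw [if_neg (by omega)]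
    ring

end Counting

end KCommute

theorem mainTheorem4 (n : ℕ) (β : Equiv.Perm (Fin n)) (c : ℕ → ℕ)
    (hc : ∀ i, c i = KCommute.cycleCount β i) :
    KCommute.numKCommuting 4 β =
        KCommute.numOfType {4} β + KCommute.numOfType {3, 1} β
          + KCommute.numOfType {2, 2} β + KCommute.numOfType {2, 1, 1} β ∧
    KCommute.numOfType {4} β =
        KCommute.centralizerOrder β * ∑ i ∈ Finset.Icc 4 n, c i * i.choose 4 ∧
    KCommute.numOfType {3, 1} β =
        KCommute.centralizerOrder β *
          ∑ i ∈ Finset.Icc 1 n, ∑ j ∈ Finset.Icc (i + 2) n, i * j * (j - i - 1) * c i * c j ∧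
    KCommute.numOfType {2, 2} β =
        KCommute.centralizerOrder β *
          ((∑ i ∈ Finset.Icc 2 n, i * i.choose 2 * (c i).choose 2) +
            ∑ i ∈ Finset.Icc 2 n, ∑ j ∈ Finset.Icc (i + 1) n,
              i * (i - 1) * j * c i * c j) ∧
    KCommute.numOfType {2, 1, 1} β =
        KCommute.centralizerOrder β *
          ((∑ i ∈ Finset.Icc 1 n, i ^ 3 * c (2 * i) * (c i).choose 2) +
            ∑ i ∈ Finset.Icc 1 n, ∑ j ∈ Finset.Icc (i + 1) n,
              i * j * (i + j) * c i * c j * c (i + j)) := by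
  obtain rfl : c = KCommute.cycleCount β := funext hc
  have h4 := KCommute.eight_mul_numPerturb_four (f := β)
  have h31 := KCommute.eight_mul_numPerturb_three_one (f := β)
  have h22 := KCommute.eight_mul_numPerturb_two_two (f := β)
  have h211 := KCommute.eight_mul_numPerturb_two_one_one (f := β)
  rw [KCommute.quad_pattern4] at h4
  rw [KCommute.quad_pattern31] at h31
  rw [KCommute.quad_pattern22] at h22
  rw [KCommute.quad_pattern211] at h211
  have hsum : ({4} : Multiset ℕ).sum = 4 ∧ ({3, 1} : Multiset ℕ).sum = 4 ∧
      ({2, 2} : Multiset ℕ).sum = 4 ∧ ({2, 1, 1} : Multiset ℕ).sum = 4 := by decide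
  rw [KCommute.numKCommuting_eq, KCommute.numOfType_eq, KCommute.numOfType_eq,
    KCommute.numOfType_eq, KCommute.numOfType_eq, hsum.1, hsum.2.1, hsum.2.2.1, hsum.2.2.2,
    KCommute.numPerturb_four_eq_add]
  -- The constants are `8`, `4 * 2`, `2 * 4` and `2 * 4`, so the factor 8 cancels in all four cases.
  refine ⟨by ring, congrArg _ ?_, congrArg _ ?_, congrArg _ ?_, congrArg _ ?_⟩ <;> omega
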